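/- Let $a<0<b$ be real numbers, and let $k_0:(a,0)\to\mathbb R$ and $k_1:(0,b)\to\mathbb R$ be smooth functions, each bounded above and bounded below by a positive constant. Let $H_0^2(a,b)$ be the closure of $C_0^\infty(a,b)$ with respect to the norm $\|u\|=\left(\int_a^b|u''|^2\,dx\right)^{1/2}$ (real-valued functions), and for $\varepsilon\in(0,1)$ put $$a_\varepsilon(\varphi,\psi)=\int_a^0 k_0\,\varphi''\psi''\,dx+\varepsilon^4\int_0^b k_1\,\varphi''\psi''\,dx ,\qquad \varphi,\psi\in H_0^2(a,b).$$ Call $\lambda\in\mathbb R$ an eigenvalue (for the parameter $\varepsilon$) if there is a nonzero $u\in H_0^2(a,b)$ such that $a_\varepsilon(u,\varphi)-\lambda\,(u,\varphi)_{L_2(a,b)}=0$ for all $\varphi\in H_0^2(a,b)$. **Lemma 2.1.** For each $\varepsilon\in(0,1)$ the set of eigenvalues is $\{\lambda_i^\varepsilon\}_{i=1}^\infty$ for a sequence $0<\lambda_1^\varepsilon<\lambda_2^\varepsilon<\cdots<\lambda_i^\varepsilon<\cdots$ with $\lambda_i^\varepsilon\to\infty$ as $i\to\infty$. For each $i\ge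 1$, the function $\varepsilon\mapsto\lambda_i^\varepsilon$ is continuous on $(0,1)$, and there is a constant $C_i$, independent of $\varepsilon$, such that $$\lambda_i^\varepsilon\le C_i\,\varepsilon^4\qquad\text{for all }\varepsilon\in(0,1).$$ -/

import Mathlib

open MeasureTheory Set Filter Topology
open scoped ContDiff

namespace StiffRod

/-- The real Hilbert space `L²(a, b)` with respect to Lebesgue measure. -/
abbrev L2 (a b : ℝ) : Type := Lp ℝ 2 (volume.restrict (Ioo a b))

/-- `φ ∈ C₀^∞(a, b)`: smooth on the line, with compact support contained in `(a, b)`. -/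
structure IsTestFunction (a b : ℝ) (φ : ℝ → ℝ) : Prop where
  smooth : ContDiff ℝ ∞ φ
  compact : HasCompactSupport φ
  support : tsupport φ ⊆ Ioo a b

/-- The space `C₀^∞(a, b)`, a function `φ` being recorded as the pair `(φ, φ'')` of elements
of `L²(a, b)`. -/
noncomputable def testGraph (a b : ℝ) : Submodule ℝ (L2 a b × L2 a b) where
  carrier := {p | ∃ φ : ℝ → ℝ, IsTestFunction a b φ ∧
    p.1 =ᵐ[volume.restrict (Ioo a b)] φ ∧
    p.2 =ᵐ[volume.restrict (Ioo a b)] iteratedDeriv 2 φ}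
  zero_mem' := by
    refine ⟨fun _ => 0, ⟨contDiff_const, HasCompactSupport.zero, ?_⟩, ?_, ?_⟩
    · simp [tsupport]
    · exact Lp.coeFn_zero _ _ _
    · have h : iteratedDeriv 2 (fun _ : ℝ => (0 : ℝ)) = 0 := by
        ext x; simp
      rw [h]; exact Lp.coeFn_zero _ _ _
  add_mem' := by
    rintro p q ⟨φ, hφ, hp1, hp2⟩ ⟨ψ, hψ, hq1, hq2⟩
    refine ⟨φ + ψ, ⟨hφ.smooth.add hψ.smooth, hφ.compact.add hψ.compact,
      (tsupport_add φ ψ).trans (union_subset hφ.support hψ.support)⟩, ?_, ?_⟩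
    · exact (Lp.coeFn_add _ _).trans (hp1.add hq1)
    · have h : iteratedDeriv 2 (φ + ψ) = iteratedDeriv 2 φ + iteratedDeriv 2 ψ := by
        ext x
        exact iteratedDeriv_add (contDiff_infty.1 hφ.smooth 2).contDiffAt
          (contDiff_infty.1 hψ.smooth 2).contDiffAt
      rw [h]; exact (Lp.coeFn_add _ _).trans (hp2.add hq2)
  smul_mem' := by
    rintro c p ⟨φ, hφ, hp1, hp2⟩
    refine ⟨c • φ, ⟨contDiff_const.smul hφ.smooth, hφ.compact.smul_left (f := fun _ => c),
      (closure_mono (Function.support_const_smul_subset c φ)).trans hφ.support⟩, ?_, ?_⟩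
    · exact (Lp.coeFn_smul _ _).trans (hp1.const_smul c)
    · have h : iteratedDeriv 2 (c • φ) = c • iteratedDeriv 2 φ := by
        ext x
        exact iteratedDeriv_const_smul (contDiff_infty.1 hφ.smooth 2).contDiffAt c
      rw [h]; exact (Lp.coeFn_smul _ _).trans (hp2.const_smul c)

/-- The Sobolev space `H₀²(a, b)`: the closure of `C₀^∞(a, b)` for the norm `‖u''‖_{L²(a,b)}`.
An element is the pair `(u, u'')` of a function and its weak second derivative, and `u''` is
determined by `u`. Since `‖φ‖_{L²} ≤ C ‖φ''‖_{L²}` on `C₀^∞(a, b)`, convergence of the pairs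
`(φₙ, φₙ'')` in `L² × L²` is the same as convergence in the norm `‖φ''‖_{L²}`. -/
noncomputable def H02 (a b : ℝ) : Submodule ℝ (L2 a b × L2 a b) := (testGraph a b).topologicalClosure

/-- `a₀(φ, ψ) = ∫_a^0 k₀ φ'' ψ''`. -/
noncomputable def form0 {a b : ℝ} (k₀ : ℝ → ℝ) (p q : L2 a b × L2 a b) : ℝ :=
  ∫ x in Ioo a 0, k₀ x * p.2 x * q.2 x

/-- `a₁(φ, ψ) = ∫_0^b k₁ φ'' ψ''`. -/
noncomputable def form1 {a b : ℝ} (k₁ : ℝ → ℝ) (p q : L2 a b × L2 a b) : ℝ :=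
  ∫ x in Ioo 0 b, k₁ x * p.2 x * q.2 x

/-- `a_ε = a₀ + ε⁴ a₁`. -/
noncomputable def formEps {a b : ℝ} (k₀ k₁ : ℝ → ℝ) (ε : ℝ) (p q : L2 a b × L2 a b) : ℝ :=
  form0 k₀ p q + ε ^ 4 * form1 k₁ p q

/-- `μ` is an eigenvalue: some nonzero `u ∈ H₀²(a, b)` satisfies
`a_ε(u, φ) - μ (u, φ)_{L²(a,b)} = 0` for all `φ ∈ H₀²(a, b)`. -/
def IsEigenvalue (a b : ℝ) (k₀ k₁ : ℝ → ℝ) (ε μ : ℝ) : Prop :=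
  ∃ u ∈ H02 a b, u.1 ≠ 0 ∧
    ∀ φ ∈ H02 a b, formEps k₀ k₁ ε u φ - μ * inner ℝ u.1 φ.1 = 0

/-- The eigenvalues listed in increasing order, counted from `0`: the value at `i` is the
`(i + 1)`-st smallest eigenvalue. -/
noncomputable def eigenvalue (a b : ℝ) (k₀ k₁ : ℝ → ℝ) (ε : ℝ) : ℕ → ℝ
  | 0 => sInf {μ | IsEigenvalue a b k₀ k₁ ε μ}
  | i + 1 => sInf {μ | IsEigenvalue a b k₀ k₁ ε μ ∧ eigenvalue a b k₀ k₁ ε i < μ}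

end StiffRod

/-! The problem is treated as an abstract one: a bounded symmetric coercive form `B` on `H02 a b`, a
compact map `J` into `L2 a b`, and the equation `B u φ = μ ⟪J u, J φ⟫`. Compactness of `J` holds
because every `u` in `H02 a b` is the twofold primitive of `u''`, and this primitive maps bounded
sets of `L2 a b` to equicontinuous ones. Minimizing the Rayleigh quotient on the `J`-orthogonal
complement of finitely many eigenvectors yields a further eigenvector
(`exists_eigenvector_orthogonal`), while compactness leaves only finitely many eigenvalues below any
level (`finite_eigenvalues_le`).

The strict inequalities require simple eigenvalues. For a weak solution, the bending moment `κ u''`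
equals `α + β (x - a)` plus `μ` times the twofold primitive of `u` (`exists_moment_eq`). If `α = 0`,
then after a change of sign `β ≥ 0`, and positivity propagates from `a`: a Grönwall argument gives
`u'' ≥ 0`, while `u'(a) = u'(b) = 0` gives `u''` mean zero, so `u = 0`. Hence a solution is
determined by `α`, and eigenspaces are lines (`simpleSpectrum`).

With simplicity, counting eigenvalues as a set is the same as counting with multiplicity, and one
half of the min-max principle suffices: a subspace of dimension `n + 1` whose Rayleigh quotients are
at most `Λ` forces the eigenvalue of index `n` to be at most `Λ` (`eigenvalue_le_of_submodule`). It
is used with two kinds of trial space. Functions supported in `(0, b)` do not see `a₀`, so their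
quotients are of order `ε ^ 4`; this gives infinitely many eigenvalues and the upper bound. The
first `n + 1` eigenvectors for another parameter `δ` compare the eigenvalues at `ε` and `δ` up to
the factor `max 1 ((ε / δ) ^ 4)`, which gives continuity. -/

namespace StiffRod

/-! ### Variational theory of a coercive form relative to a compact map -/

section Variational

variable {E L : Type*} [NormedAddCommGroup E] [NormedSpace ℝ E]
  [NormedAddCommGroup L] [InnerProductSpace ℝ L]

/-- `u` is an eigenvector of the form `B` relative to `⟪J ·, J ·⟫`, with eigenvalue `μ`. -/
def IsFormEigenvector (B : E →L[ℝ] E →L[ℝ] ℝ) (J : E →L[ℝ] L) (μ : ℝ) (u : E) : Prop :=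
  J u ≠ 0 ∧ ∀ φ, B u φ = μ * inner ℝ (J u) (J φ)

variable {B : E →L[ℝ] E →L[ℝ] ℝ} {J : E →L[ℝ] L}

theorem IsFormEigenvector.smul {μ : ℝ} {u : E} (h : IsFormEigenvector B J μ u) {c : ℝ}
    (hc : c ≠ 0) : IsFormEigenvector B J μ (c • u) := by
  refine ⟨by simpa [hc] using h.1, fun φ => ?_⟩
  simp only [map_smul, smul_apply, h.2 φ, inner_smul_left, smul_eq_mul]
  simp only [conj_trivial]; ring

theorem IsFormEigenvector.inner_eq_zero (hs : ∀ u v, B u v = B v u) {μ ν : ℝ} {u v : E}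
    (hu : IsFormEigenvector B J μ u) (hv : IsFormEigenvector B J ν v) (h : μ ≠ ν) :
    inner ℝ (J u) (J v) = 0 := by
  have h1 := hu.2 v
  rw [hs, hv.2 u, real_inner_comm] at h1
  have : (μ - ν) * inner ℝ (J u) (J v) = 0 := by linarith
  exact (mul_eq_zero.1 this).resolve_left (sub_ne_zero.2 h)

theorem IsFormEigenvector.self_apply {μ : ℝ} {u : E} (h : IsFormEigenvector B J μ u) :
    B u u = μ * ‖J u‖ ^ 2 := by
  rw [h.2 u, real_inner_self_eq_norm_sq]

theorem IsFormEigenvector.pos {c : ℝ} (hc : 0 < c) (hB : ∀ u, c * ‖u‖ ^ 2 ≤ B u u)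
    {μ : ℝ} {u : E} (h : IsFormEigenvector B J μ u) : 0 < μ := by
  have h1 := hB u
  rw [h.self_apply] at h1
  have hu : u ≠ 0 := fun h0 => h.1 (by simp [h0])
  have h2 : 0 < c * ‖u‖ ^ 2 := by positivity
  have h3 : 0 < ‖J u‖ ^ 2 := by have := norm_pos_iff.2 h.1; positivity
  exact pos_of_mul_pos_left (h2.trans_le h1) h3.le

/-- The parallelogram law, which makes minimizing sequences Cauchy. -/
theorem form_sub_self (hs : ∀ u v, B u v = B v u) (u v : E) :
    B (u - v) (u - v) = 2 * B u u + 2 * B v v - B (u + v) (u + v) := by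
  simp only [map_sub, map_add, sub_apply, add_apply]
  rw [hs v u]; ring

theorem exists_tendsto_comp_of_bounded (hJ : IsCompactOperator J) {u : ℕ → E} {R : ℝ}
    (hu : ∀ n, ‖u n‖ ≤ R) :
    ∃ y, ∃ φ : ℕ → ℕ, StrictMono φ ∧ Tendsto (fun n => J (u (φ n))) atTop (𝓝 y) := by
  have hc := hJ.isCompact_closure_image_closedBall R
  obtain ⟨y, -, φ, hφ, h⟩ := hc.tendsto_subseq (x := fun n => J (u n)) (fun n =>
    subset_closure ⟨u n, by simpa using hu n, rfl⟩)
  exact ⟨y, φ, hφ, h⟩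

/-- A positive semidefinite symmetric form vanishes against its null vectors. -/
theorem bilin_eq_zero_of_nonneg {V : Type*} [AddCommGroup V] [Module ℝ V]
    (Q : V →ₗ[ℝ] V →ₗ[ℝ] ℝ) (hs : ∀ u v, Q u v = Q v u) (X : Submodule ℝ V)
    (hQ : ∀ u ∈ X, 0 ≤ Q u u) {u v : V} (hu : u ∈ X) (hv : v ∈ X) (h0 : Q u u = 0) :
    Q u v = 0 := by
  have key : ∀ t : ℝ, 0 ≤ 2 * t * Q u v + t ^ 2 * Q v v := by
    intro t
    have := hQ (u + t • v) (X.add_mem hu (X.smul_mem t hv))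
    simp only [map_add, map_smul, LinearMap.add_apply, LinearMap.smul_apply, smul_eq_mul, h0,
      hs v u] at this
    linarith
  by_contra hne
  have hvv := hQ v hv
  -- The `+ 1` keeps the denominator positive when `Q v v = 0`; the resulting value is still
  -- strictly negative if `Q u v ≠ 0`.
  have h1 := key (-(Q u v) / (Q v v + 1))
  have hp : 0 < Q v v + 1 := by linarith
  have h2 : 2 * (-(Q u v) / (Q v v + 1)) * Q u v + (-(Q u v) / (Q v v + 1)) ^ 2 * Q v v
      = -(Q u v) ^ 2 * (Q v v + 2) / (Q v v + 1) ^ 2 := by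
    field_simp; ring
  rw [h2] at h1
  have h3 : 0 < (Q u v) ^ 2 * (Q v v + 2) / (Q v v + 1) ^ 2 := by positivity
  have h4 : -(Q u v) ^ 2 * (Q v v + 2) / (Q v v + 1) ^ 2
    = -((Q u v) ^ 2 * (Q v v + 2) / (Q v v + 1) ^ 2) := by ring
  linarith

/-- The Rayleigh quotient attains its infimum over a closed subspace. -/
theorem exists_rayleigh_minimizer [CompleteSpace E] (hs : ∀ u v, B u v = B v u) {c : ℝ}
    (hc : 0 < c) (hB : ∀ u, c * ‖u‖ ^ 2 ≤ B u u) (hJ : IsCompactOperator J)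
    (X : Submodule ℝ E) (hX : IsClosed (X : Set E)) {w : E} (hw : w ∈ X) (hw0 : J w ≠ 0) :
    ∃ v ∈ X, ‖J v‖ = 1 ∧ ∀ u ∈ X, B v v * ‖J u‖ ^ 2 ≤ B u u := by
  set T : Set ℝ := {r | ∃ u ∈ X, ‖J u‖ = 1 ∧ B u u = r} with hT
  have hscale : ∀ u ∈ X, J u ≠ 0 → B u u / ‖J u‖ ^ 2 ∈ T := by
    intro u hu h0
    have hn : ‖J u‖ ≠ 0 := norm_ne_zero_iff.2 h0
    refine ⟨‖J u‖⁻¹ • u, X.smul_mem _ hu, ?_, ?_⟩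
    · simp [norm_smul, hn]
    · simp only [map_smul, smul_apply, smul_eq_mul]; field_simp
  have hTne : T.Nonempty := ⟨_, hscale w hw hw0⟩
  have hBpos : ∀ u, 0 ≤ B u u := fun u => le_trans (by positivity) (hB u)
  have hTb : BddBelow T := ⟨0, by rintro r ⟨u, -, -, rfl⟩; exact hBpos u⟩
  set ν := sInf T with hν
  have hle : ∀ u ∈ X, ν * ‖J u‖ ^ 2 ≤ B u u := by
    intro u hu
    by_cases h0 : J u = 0
    · simpa [h0] using hBpos u
    · have := csInf_le hTb (hscale u hu h0)
      have hn : 0 < ‖J u‖ := norm_pos_iff.2 h0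
      rwa [← hν, le_div_iff₀ (by positivity)] at this
  obtain ⟨r, -, hr, hrT⟩ := exists_seq_tendsto_sInf hTne hTb
  choose u huX hu1 hur using hrT
  have hbd : ∃ R, ∀ n, ‖u n‖ ≤ R := by
    obtain ⟨M, hM⟩ := hr.bddAbove_range
    refine ⟨Real.sqrt (M / c), fun n => Real.le_sqrt_of_sq_le ?_⟩
    rw [le_div_iff₀ hc]
    have h1 : r n ≤ M := hM ⟨n, rfl⟩
    have h2 := hB (u n)
    rw [hur] at h2; linarith
  obtain ⟨R, hR⟩ := hbd
  obtain ⟨y, φ, hφ, hy⟩ := exists_tendsto_comp_of_bounded hJ hR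
  have hrφ := hr.comp hφ.tendsto_atTop
  -- Only `J ∘ u` converges by compactness. Strong convergence of `u` itself comes from the
  -- parallelogram law: the energies tend to `ν`, while the sum of two terms has energy at least `ν
  -- ‖J u + J u'‖ ^ 2`, which tends to `4 ν`.
  have hcau : CauchySeq (fun n => u (φ n)) := by
    rw [Metric.cauchySeq_iff']
    intro ε hε
    have hpar : ∀ n m, c * ‖u (φ n) - u (φ m)‖ ^ 2 ≤
        2 * r (φ n) + 2 * r (φ m) - ν * ‖J (u (φ n)) + J (u (φ m))‖ ^ 2 := by
      intro n m
      have h1 := hB (u (φ n) - u (φ m))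
      rw [form_sub_self hs, hur, hur] at h1
      have h2 := hle (u (φ n) + u (φ m)) (X.add_mem (huX _) (huX _))
      rw [map_add] at h2
      linarith
    have hyn : ‖y‖ = 1 := by
      refine tendsto_nhds_unique hy.norm ?_
      simp [hu1]
    have hlim : Tendsto (fun p : ℕ × ℕ => 2 * r (φ p.1) + 2 * r (φ p.2)
        - ν * ‖J (u (φ p.1)) + J (u (φ p.2))‖ ^ 2) (atTop ×ˢ atTop) (𝓝 0) := by
      have e : (0 : ℝ) = 2 * ν + 2 * ν - ν * ‖y + y‖ ^ 2 := by
        rw [← two_smul ℝ y, norm_smul, hyn]; norm_num; ring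
      rw [e]
      have t1 := hrφ.comp (tendsto_fst (f := atTop) (g := (atTop : Filter ℕ)))
      have t2 := hrφ.comp (tendsto_snd (f := (atTop : Filter ℕ)) (g := atTop))
      have t3 := hy.comp (tendsto_fst (f := atTop) (g := (atTop : Filter ℕ)))
      have t4 := hy.comp (tendsto_snd (f := (atTop : Filter ℕ)) (g := atTop))
      exact ((t1.const_mul 2).add (t2.const_mul 2)).sub ((((t3.add t4).norm).pow 2).const_mul ν)
    rw [prod_atTop_atTop_eq] at hlim
    have := (tendsto_order.1 hlim).2 (c * ε ^ 2) (by positivity)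
    obtain ⟨N, hN⟩ := eventually_atTop.1 this
    refine ⟨max N.1 N.2, fun n hn => ?_⟩
    have h1 := hN (n, max N.1 N.2) ⟨le_trans (le_max_left _ _) hn, le_max_right _ _⟩
    have h2 := (hpar n (max N.1 N.2)).trans_lt h1
    rw [dist_eq_norm]
    exact lt_of_pow_lt_pow_left₀ 2 hε.le (lt_of_mul_lt_mul_left h2 hc.le)
  obtain ⟨v, hv⟩ := cauchySeq_tendsto_of_complete hcau
  have hvX : v ∈ X := hX.mem_of_tendsto hv (Eventually.of_forall fun n => huX _)
  have hvJ : ‖J v‖ = 1 := by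
    refine tendsto_nhds_unique ((J.continuous.tendsto v).comp hv).norm ?_
    simp [hu1]
  have hvB : B v v = ν := by
    have hcont : Continuous fun x => B x x := by fun_prop
    refine tendsto_nhds_unique ((hcont.tendsto v).comp hv) ?_
    refine hrφ.congr fun n => ?_
    simp [hur]
  exact ⟨v, hvX, hvJ, fun x hx => by rw [hvB]; exact hle x hx⟩

/-- If some vector `J`-orthogonal to the eigenvectors `u i` has Rayleigh quotient at most `Λ`,
then there is an eigenvector with eigenvalue at most `Λ` that is `J`-orthogonal to all `u i`. -/
theorem exists_eigenvector_orthogonal [CompleteSpace E] (hs : ∀ u v, B u v = B v u) {c : ℝ}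
    (hc : 0 < c) (hB : ∀ u, c * ‖u‖ ^ 2 ≤ B u u) (hJ : IsCompactOperator J)
    {ι : Type*} [Fintype ι] [DecidableEq ι] {μ : ι → ℝ} (hμ : Function.Injective μ) {u : ι → E}
    (hu : ∀ i, IsFormEigenvector B J (μ i) (u i)) {w : E} (hw : ∀ i, inner ℝ (J (u i)) (J w) = 0)
    (hw0 : J w ≠ 0) {Λ : ℝ} (hΛ : B w w ≤ Λ * ‖J w‖ ^ 2) :
    ∃ ν ≤ Λ, ∃ v, IsFormEigenvector B J ν v ∧ ∀ i, inner ℝ (J (u i)) (J v) = 0 := by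
  let X : Submodule ℝ E := ⨅ i, LinearMap.ker ((innerSL ℝ (J (u i))).comp J : E →ₗ[ℝ] ℝ)
  have hmem : ∀ x, x ∈ X ↔ ∀ i, inner ℝ (J (u i)) (J x) = 0 := by
    intro x; simp [X, Submodule.mem_iInf]
  have hXc : IsClosed (X : Set E) := by
    have : (X : Set E) = ⋂ i, {x | inner ℝ (J (u i)) (J x) = 0} := by
      ext x; simp [hmem]
    rw [this]
    exact isClosed_iInter fun i => isClosed_eq (by fun_prop) continuous_const
  obtain ⟨v, hvX, hv1, hmin⟩ := exists_rayleigh_minimizer hs hc hB hJ X hXc ((hmem w).2 hw) hw0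
  have hv0 : J v ≠ 0 := fun h => by simp [h] at hv1
  refine ⟨B v v, ?_, v, ⟨hv0, ?_⟩, (hmem v).1 hvX⟩
  · have h1 := (hmin w ((hmem w).2 hw)).trans hΛ
    have : 0 < ‖J w‖ := norm_pos_iff.2 hw0
    exact le_of_mul_le_mul_right h1 (by positivity)
  set ν := B v v with hν
  -- Minimality says that `Q` is nonnegative on `X` with null vector `v`, so `Q v` vanishes on `X`.
  -- It vanishes on each `u i` as well, and `X` together with the `u i` spans `E`.
  let Q : E →ₗ[ℝ] E →ₗ[ℝ] ℝ := LinearMap.mk₂ ℝ (fun x y => B x y - ν * inner ℝ (J x) (J y))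
    (by intros; simp [inner_add_left]; ring) (by intros; simp [inner_smul_left]; ring)
    (by intros; simp [inner_add_right]; ring) (by intros; simp [inner_smul_right]; ring)
  have hQ : ∀ x y, Q x y = B x y - ν * inner ℝ (J x) (J y) := fun _ _ => rfl
  have hQs : ∀ x y, Q x y = Q y x := fun x y => by rw [hQ, hQ, hs, real_inner_comm]
  have hzero : ∀ x ∈ X, Q v x = 0 := fun x hx => by
    refine bilin_eq_zero_of_nonneg Q hQs X (fun x hx => ?_) hvX hx ?_
    · rw [hQ, real_inner_self_eq_norm_sq]; linarith [hmin x hx]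
    · rw [hQ, real_inner_self_eq_norm_sq, hv1]; simp [hν]
  have huz : ∀ i, Q v (u i) = 0 := fun i => by
    rw [hQ, hs, (hu i).2, real_inner_comm (J (u i)) (J v), (hmem v).1 hvX i]; simp
  intro φ
  -- The `J`-orthogonal projection of `φ` onto the span of the `u i`.
  set p : E := ∑ i, (inner ℝ (J (u i)) (J φ) / ‖J (u i)‖ ^ 2) • u i with hp
  have hq : φ - p ∈ X := by
    rw [hmem]; intro i
    rw [map_sub, inner_sub_right, hp, map_sum, inner_sum, Finset.sum_eq_single i]
    · have : ‖J (u i)‖ ≠ 0 := norm_ne_zero_iff.2 (hu i).1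
      rw [map_smul, inner_smul_right, real_inner_self_eq_norm_sq]; field_simp; simp
    · intro j _ hj
      rw [map_smul, inner_smul_right, (hu i).inner_eq_zero hs (hu j) (hμ.ne hj.symm), mul_zero]
    · simp
  have hp0 : Q v p = 0 := by simp [hp, map_sum, huz]
  have := hzero _ hq
  rw [map_sub, hp0, sub_zero, hQ] at this
  linarith

/-- Infinitely many such eigenvalues would give eigenvectors that are bounded in `E` by coercivity,
with orthonormal images under `J`. Those images are at mutual distance `√2`, against compactness of
`J`. -/
theorem finite_eigenvalues_le (hs : ∀ u v, B u v = B v u) {c : ℝ}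
    (hc : 0 < c) (hB : ∀ u, c * ‖u‖ ^ 2 ≤ B u u) (hJ : IsCompactOperator J) (Λ : ℝ) :
    {μ | (∃ u, IsFormEigenvector B J μ u) ∧ μ ≤ Λ}.Finite := by
  by_contra hinf
  let f := Set.Infinite.natEmbedding _ hinf
  have hex : ∀ n, ∃ u, IsFormEigenvector B J (f n : ℝ) u ∧ ‖J u‖ = 1 := by
    intro n
    obtain ⟨u, hu⟩ := (f n).2.1
    have hn : ‖J u‖ ≠ 0 := norm_ne_zero_iff.2 hu.1
    exact ⟨‖J u‖⁻¹ • u, hu.smul (inv_ne_zero hn), by simp [norm_smul, hn]⟩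
  choose u hu hu1 using hex
  have hR : ∀ n, ‖u n‖ ≤ Real.sqrt (Λ / c) := by
    intro n
    refine Real.le_sqrt_of_sq_le ?_
    rw [le_div_iff₀ hc]
    have h2 := hB (u n)
    rw [(hu n).self_apply, hu1] at h2
    linarith [(f n).2.2]
  obtain ⟨y, φ, hφ, hy⟩ := exists_tendsto_comp_of_bounded hJ hR
  have h := hy.cauchySeq
  rw [Metric.cauchySeq_iff'] at h
  obtain ⟨N, hN⟩ := h 1 one_pos
  have h1 := hN (N + 1) (Nat.le_succ N)
  have horth : inner ℝ (J (u (φ (N + 1)))) (J (u (φ N))) = 0 := by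
    refine (hu _).inner_eq_zero hs (hu _) fun h => ?_
    have := hφ.injective (f.injective (Subtype.ext h))
    omega
  rw [dist_eq_norm] at h1
  have h2 := norm_sub_sq_real (J (u (φ (N + 1)))) (J (u (φ N)))
  rw [horth, hu1, hu1] at h2
  have h3 := norm_nonneg (J (u (φ (N + 1))) - J (u (φ N)))
  nlinarith

/-- Eigenspaces have dimension at most one. -/
def SimpleSpectrum (B : E →L[ℝ] E →L[ℝ] ℝ) (J : E →L[ℝ] L) : Prop :=
  ∀ μ u v, IsFormEigenvector B J μ u → IsFormEigenvector B J μ v → ∃ t : ℝ, J v = t • J u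

/-- If `S` had larger dimension, some nonzero `w` in `S` would be `J`-orthogonal to one eigenvector
for each eigenvalue up to `Λ`. Its quotient is at most `Λ`, so a new eigenvector orthogonal to all
of these appears with eigenvalue at most `Λ`. That eigenvalue is already listed, and simplicity
makes the new vector parallel to a vector it is orthogonal to. -/
theorem finrank_le_ncard_eigenvalues [CompleteSpace E] (hs : ∀ u v, B u v = B v u) {c : ℝ}
    (hc : 0 < c) (hB : ∀ u, c * ‖u‖ ^ 2 ≤ B u u) (hJ : IsCompactOperator J)
    (hsimple : SimpleSpectrum B J) (S : Submodule ℝ E) [FiniteDimensional ℝ S]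
    (hS : ∀ u ∈ S, J u = 0 → u = 0) {Λ : ℝ} (hΛ : ∀ u ∈ S, B u u ≤ Λ * ‖J u‖ ^ 2) :
    Module.finrank ℝ S ≤ {μ | (∃ u, IsFormEigenvector B J μ u) ∧ μ ≤ Λ}.ncard := by
  classical
  set T := {μ | (∃ u, IsFormEigenvector B J μ u) ∧ μ ≤ Λ} with hT
  have hfin : T.Finite := finite_eigenvalues_le hs hc hB hJ Λ
  have : Fintype T := hfin.fintype
  by_contra! hlt
  have hex : ∀ i : T, ∃ u, IsFormEigenvector B J (i : ℝ) u := fun i => i.2.1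
  choose u hu using hex
  let F : S →ₗ[ℝ] (T → ℝ) :=
    LinearMap.pi fun i => (((innerSL ℝ (J (u i))).comp J : E →ₗ[ℝ] ℝ)).comp S.subtype
  have hker : LinearMap.ker F ≠ ⊥ := by
    apply LinearMap.ker_ne_bot_of_finrank_lt
    rw [Module.finrank_fintype_fun_eq_card, ← Nat.card_eq_fintype_card]
    exact hlt
  obtain ⟨w, hwF, hw0⟩ := Submodule.exists_mem_ne_zero_of_ne_bot hker
  have hw : ∀ i, inner ℝ (J (u i)) (J (w : E)) = 0 := fun i => by
    simpa [F] using congrFun (LinearMap.mem_ker.1 hwF) i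
  have hJw : J (w : E) ≠ 0 := fun h => hw0 (Subtype.ext (hS _ w.2 h))
  obtain ⟨ν, hν, v, hv, horth⟩ := exists_eigenvector_orthogonal hs hc hB hJ
    (μ := fun i : T => (i : ℝ)) Subtype.val_injective hu hw hJw (hΛ _ w.2)
  let i : T := ⟨ν, ⟨v, hv⟩, hν⟩
  obtain ⟨t, ht⟩ := hsimple ν (u i) v (hu i) hv
  have h1 := horth i
  rw [ht, inner_smul_right, real_inner_self_eq_norm_sq] at h1
  rcases mul_eq_zero.1 h1 with h | h
  · exact hv.1 (by rw [ht, h, zero_smul])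
  · exact (hu i).1 (by simpa using h)

end Variational

/-! ### Increasing enumeration of an infinite set finite below every level -/

section Enumeration

variable {X : Set ℝ}

theorem isLeast_sInf_of_finite_inter_Iic (hfin : ∀ Λ, (X ∩ Iic Λ).Finite) (hX : X.Nonempty) :
    IsLeast X (sInf X) := by
  obtain ⟨s, hs⟩ := hX
  obtain ⟨m, hm, hmin⟩ := (hfin s).exists_minimal (s := X ∩ Iic s) ⟨s, hs, le_refl s⟩
  have hl : IsLeast X m := by
    refine ⟨hm.1, fun x hx => ?_⟩
    rcases le_total x m with h | h
    · exact hmin ⟨hx, h.trans hm.2⟩ h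
    · exact h
  rwa [hl.csInf_eq]

variable {e : ℕ → ℝ} (hinf : X.Infinite) (hfin : ∀ Λ, (X ∩ Iic Λ).Finite) (h0 : e 0 = sInf X)
  (hsucc : ∀ i, e (i + 1) = sInf {μ | μ ∈ X ∧ e i < μ})

include hinf hfin in
theorem isLeast_sInf_gt (c : ℝ) :
    IsLeast {μ | μ ∈ X ∧ c < μ} (sInf {μ | μ ∈ X ∧ c < μ}) := by
  refine isLeast_sInf_of_finite_inter_Iic
    (fun Λ => (hfin Λ).subset fun x hx => ⟨hx.1.1, hx.2⟩) ?_
  obtain ⟨x, hx, hc⟩ := (hinf.sdiff (hfin c)).nonempty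
  exact ⟨x, hx, not_le.1 fun h => hc ⟨hx, h⟩⟩

include hinf hfin h0 hsucc

theorem enum_mem (i : ℕ) : e i ∈ X := by
  cases i with
  | zero => rw [h0]; exact (isLeast_sInf_of_finite_inter_Iic hfin hinf.nonempty).1
  | succ i => rw [hsucc]; exact (isLeast_sInf_gt hinf hfin _).1.1

omit h0 in
theorem enum_strictMono : StrictMono e := by
  refine strictMono_nat_of_lt_succ fun i => ?_
  rw [hsucc]; exact (isLeast_sInf_gt hinf hfin _).1.2

theorem exists_lt_enum (c : ℝ) : ∃ i, c < e i := by
  by_contra! h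
  have hm := enum_strictMono hinf hfin hsucc
  exact (Set.infinite_range_of_injective hm.injective) ((hfin c).subset (by
    rintro _ ⟨i, rfl⟩
    exact ⟨enum_mem hinf hfin h0 hsucc i, h i⟩))

theorem enum_tendsto : Tendsto e atTop atTop :=
  tendsto_atTop_atTop_of_monotone (enum_strictMono hinf hfin hsucc).monotone fun c =>
    (exists_lt_enum hinf hfin h0 hsucc c).imp fun _ h => h.le

/-- Each `e i` is the least candidate left, so an element that has not been listed stays above it.
As `e` is unbounded, nothing can be skipped forever. -/
theorem enum_lt_of_notMem {x : ℝ} (hx : x ∈ X) {n : ℕ} (hn : ∀ i < n, e i ≠ x) :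
    ∀ i < n, e i < x := by
  intro i
  induction i with
  | zero =>
    intro h
    refine lt_of_le_of_ne ?_ (hn 0 h)
    rw [h0]; exact (isLeast_sInf_of_finite_inter_Iic hfin hinf.nonempty).2 hx
  | succ i ih =>
    intro h
    refine lt_of_le_of_ne ?_ (hn _ h)
    rw [hsucc]; exact (isLeast_sInf_gt hinf hfin _).2 ⟨hx, ih (by omega)⟩

theorem range_enum : range e = X := by
  refine Subset.antisymm ?_ fun x hx => ?_
  · rintro _ ⟨i, rfl⟩; exact enum_mem hinf hfin h0 hsucc i
  · by_contra h
    obtain ⟨i, hi⟩ := exists_lt_enum hinf hfin h0 hsucc x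
    exact (enum_lt_of_notMem hinf hfin h0 hsucc hx (n := i + 1)
      (fun j _ hj => h ⟨j, hj⟩) i (by omega)).not_gt hi

theorem enum_le_of_lt_ncard {n : ℕ} {Λ : ℝ} (h : n < (X ∩ Iic Λ).ncard) : e n ≤ Λ := by
  by_contra! hlt
  -- Once `Λ < e n`, only the `n` values with index below `n` can lie under `Λ`.
  have hsub : X ∩ Iic Λ ⊆ e '' (Finset.range n : Set ℕ) := by
    rintro x ⟨hx, hxΛ⟩
    rw [← range_enum hinf hfin h0 hsucc] at hx
    obtain ⟨i, rfl⟩ := hx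
    refine ⟨i, ?_, rfl⟩
    have := (enum_strictMono hinf hfin hsucc).lt_iff_lt.1 (lt_of_le_of_lt hxΛ hlt)
    simpa using this
  have h1 := Set.ncard_le_ncard hsub ((Finset.finite_toSet _).image _)
  have h2 := Set.ncard_image_le (f := e) (Finset.finite_toSet (Finset.range n))
  rw [Set.ncard_coe_finset, Finset.card_range] at h2
  omega

end Enumeration

/-! ### Finite-dimensional trial spaces -/

section Comparison

variable {E L : Type*} [NormedAddCommGroup E] [NormedSpace ℝ E]
  [NormedAddCommGroup L] [InnerProductSpace ℝ L]
  {B : E →L[ℝ] E →L[ℝ] ℝ} {J : E →L[ℝ] L}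

/-- The span of `n` eigenvectors with distinct eigenvalues at most `Λ`. -/
theorem exists_submodule_of_eigenvectors (hs : ∀ u v, B u v = B v u) {n : ℕ} {μ : Fin n → ℝ}
    (hμ : Function.Injective μ) {u : Fin n → E} (hu : ∀ i, IsFormEigenvector B J (μ i) (u i))
    {Λ : ℝ} (hΛ : ∀ i, μ i ≤ Λ) :
    ∃ S : Submodule ℝ E, FiniteDimensional ℝ S ∧ Module.finrank ℝ S = n ∧
      (∀ u ∈ S, J u = 0 → u = 0) ∧ ∀ u ∈ S, B u u ≤ Λ * ‖J u‖ ^ 2 := by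
  have horth : ∀ i j, i ≠ j → inner ℝ (J (u i)) (J (u j)) = 0 := fun i j h =>
    (hu i).inner_eq_zero hs (hu j) (hμ.ne h)
  have hinner : ∀ (c : Fin n → ℝ) i, inner ℝ (J (u i)) (J (∑ j, c j • u j))
      = c i * ‖J (u i)‖ ^ 2 := by
    intro c i
    rw [map_sum, inner_sum, Finset.sum_eq_single i]
    · rw [map_smul, inner_smul_right, real_inner_self_eq_norm_sq]
    · intro j _ hj
      rw [map_smul, inner_smul_right, horth i j hj.symm, mul_zero]
    · simp
  have hli : LinearIndependent ℝ u := by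
    rw [Fintype.linearIndependent_iff]
    intro c hc i
    have := hinner c i
    rw [hc, map_zero, inner_zero_right] at this
    have hn : ‖J (u i)‖ ≠ 0 := norm_ne_zero_iff.2 (hu i).1
    exact (mul_eq_zero.1 this.symm).resolve_right (pow_ne_zero 2 hn)
  refine ⟨Submodule.span ℝ (range u), FiniteDimensional.span_of_finite ℝ (finite_range u), ?_,
    ?_, ?_⟩
  · simpa using finrank_span_eq_card hli
  · intro x hx h
    obtain ⟨c, rfl⟩ := (Submodule.mem_span_range_iff_exists_fun ℝ).1 hx
    refine Finset.sum_eq_zero fun i _ => ?_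
    have := hinner c i
    rw [h, inner_zero_right] at this
    have hn : ‖J (u i)‖ ≠ 0 := norm_ne_zero_iff.2 (hu i).1
    rw [(mul_eq_zero.1 this.symm).resolve_right (pow_ne_zero 2 hn), zero_smul]
  · intro x hx
    obtain ⟨c, rfl⟩ := (Submodule.mem_span_range_iff_exists_fun ℝ).1 hx
    set x := ∑ j, c j • u j with hxdef
    have h1 : B x x = ∑ i, c i ^ 2 * (μ i * ‖J (u i)‖ ^ 2) := by
      conv_lhs => arg 2; rw [hxdef]
      rw [map_sum]
      refine Finset.sum_congr rfl fun i _ => ?_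
      rw [map_smul, hs, (hu i).2, hinner]; simp only [smul_eq_mul]; ring
    have h2 : ‖J x‖ ^ 2 = ∑ i, c i ^ 2 * ‖J (u i)‖ ^ 2 := by
      rw [← real_inner_self_eq_norm_sq]
      conv_lhs => arg 2; rw [hxdef, map_sum]
      rw [sum_inner]
      refine Finset.sum_congr rfl fun i _ => ?_
      rw [map_smul, real_inner_smul_left, hinner]; ring
    rw [h1, h2, Finset.mul_sum]
    refine Finset.sum_le_sum fun i _ => ?_
    have := mul_le_mul_of_nonneg_left (hΛ i) (by positivity : 0 ≤ c i ^ 2 * ‖J (u i)‖ ^ 2)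
    linarith

/-- On a finite-dimensional space where `J` is injective the form is bounded by `‖J ·‖²`. -/
theorem exists_form_le_mul_norm_sq (S : Submodule ℝ E) [FiniteDimensional ℝ S]
    (hS : ∀ u ∈ S, J u = 0 → u = 0) (D : E →L[ℝ] E →L[ℝ] ℝ) :
    ∃ C : ℝ, 0 ≤ C ∧ ∀ u ∈ S, D u u ≤ C * ‖J u‖ ^ 2 := by
  let F : S →ₗ[ℝ] L := (J : E →ₗ[ℝ] L).comp S.subtype
  have hF : LinearMap.ker F = ⊥ := by
    rw [LinearMap.ker_eq_bot']
    intro x hx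
    exact Subtype.ext (hS x x.2 hx)
  obtain ⟨K, -, hK⟩ := F.exists_antilipschitzWith hF
  refine ⟨‖D‖ * K ^ 2, by positivity, fun u hu => ?_⟩
  have h1 : ‖u‖ ≤ K * ‖J u‖ := by
    have := hK.le_mul_norm (map_zero F) ⟨u, hu⟩
    simpa [F] using this
  calc D u u ≤ ‖D u u‖ := le_abs_self _
    _ ≤ ‖D‖ * ‖u‖ * ‖u‖ := D.le_opNorm₂ u u
    _ = ‖D‖ * ‖u‖ ^ 2 := by ring
    _ ≤ ‖D‖ * (K * ‖J u‖) ^ 2 := by gcongr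
    _ = _ := by ring

end Comparison

/-! ### The twofold primitive and its compactness on `L²` -/

section DoubleIntegral

variable {a b : ℝ}

/-- The twofold primitive `x ↦ ∫_a^x (x - t) w(t) dt` of a function on `(a, b)`. -/
noncomputable def doublePrimitive (a b : ℝ) (w : ℝ → ℝ) (x : ℝ) : ℝ :=
  ∫ t in Ioo a b, max (x - t) 0 * w t

theorem integrableOn_kernel_mul {w : ℝ → ℝ} (hw : IntegrableOn w (Ioo a b)) (x : ℝ) :
    IntegrableOn (fun t => max (x - t) 0 * w t) (Ioo a b) := by
  refine Integrable.bdd_mul (c := |x - a| + |b - a|) hw (by fun_prop) ?_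
  filter_upwards [ae_restrict_mem measurableSet_Ioo] with t ht
  rw [Real.norm_eq_abs, abs_of_nonneg (le_max_right _ _)]
  refine max_le ?_ (by positivity)
  have := le_abs_self (x - a)
  have := abs_nonneg (b - a)
  linarith [ht.1]

theorem doublePrimitive_add {v w : ℝ → ℝ} (hv : IntegrableOn v (Ioo a b))
    (hw : IntegrableOn w (Ioo a b)) (x : ℝ) :
    doublePrimitive a b (v + w) x = doublePrimitive a b v x + doublePrimitive a b w x := by
  unfold doublePrimitive
  rw [← integral_add (integrableOn_kernel_mul hv x) (integrableOn_kernel_mul hw x)]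
  simp [mul_add]

theorem doublePrimitive_smul (c : ℝ) (w : ℝ → ℝ) (x : ℝ) :
    doublePrimitive a b (c • w) x = c * doublePrimitive a b w x := by
  unfold doublePrimitive
  rw [← integral_const_mul]
  refine integral_congr_ae (Eventually.of_forall fun t => ?_)
  simp only [Pi.smul_apply, smul_eq_mul]; ring

theorem doublePrimitive_congr {v w : ℝ → ℝ} (h : v =ᵐ[volume.restrict (Ioo a b)] w) :
    doublePrimitive a b v = doublePrimitive a b w := by
  ext x
  exact integral_congr_ae (h.mono fun t ht => by simp only [ht])

theorem doublePrimitive_mono {v w : ℝ → ℝ} (hv : IntegrableOn v (Ioo a b))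
    (hw : IntegrableOn w (Ioo a b)) (h : v ≤ᵐ[volume.restrict (Ioo a b)] w) (x : ℝ) :
    doublePrimitive a b v x ≤ doublePrimitive a b w x :=
  integral_mono_ae (integrableOn_kernel_mul hv x) (integrableOn_kernel_mul hw x)
    (h.mono fun _ ht => mul_le_mul_of_nonneg_left ht (le_max_right _ _))

/-- The kernel `max (x - t) 0` is 1-Lipschitz in `x`. This estimate supplies continuity, the sup
bound (by comparison with the value `0` at `a`) and equicontinuity. -/
theorem abs_doublePrimitive_sub_le {w : ℝ → ℝ} (hw : IntegrableOn w (Ioo a b)) (x y : ℝ) :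
    |doublePrimitive a b w x - doublePrimitive a b w y| ≤ |x - y| * ∫ t in Ioo a b, |w t| := by
  unfold doublePrimitive
  rw [← integral_sub (integrableOn_kernel_mul hw x) (integrableOn_kernel_mul hw y),
    ← integral_const_mul, ← Real.norm_eq_abs (∫ _ in _, _)]
  refine norm_integral_le_of_norm_le (hw.abs.const_mul _) (Eventually.of_forall fun t => ?_)
  rw [← sub_mul, norm_mul, Real.norm_eq_abs, Real.norm_eq_abs]
  refine mul_le_mul_of_nonneg_right ?_ (abs_nonneg _)
  have := abs_max_sub_max_le_abs (x - t) (y - t) 0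
  simpa using this

theorem continuous_doublePrimitive {w : ℝ → ℝ} (hw : IntegrableOn w (Ioo a b)) :
    Continuous (doublePrimitive a b w) := by
  refine (LipschitzWith.of_dist_le_mul (K := Real.toNNReal (∫ t in Ioo a b, |w t|))
    fun x y => ?_).continuous
  rw [Real.coe_toNNReal _ (integral_nonneg fun _ => abs_nonneg _), Real.dist_eq, Real.dist_eq,
    mul_comm]
  exact abs_doublePrimitive_sub_le hw x y

theorem doublePrimitive_left (w : ℝ → ℝ) : doublePrimitive a b w a = 0 := by
  unfold doublePrimitive
  rw [setIntegral_congr_fun (g := fun _ => 0) measurableSet_Ioo, integral_zero]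
  intro t ht
  simp [max_eq_right (sub_nonpos.2 ht.1.le)]

theorem abs_doublePrimitive_le {w : ℝ → ℝ} (hw : IntegrableOn w (Ioo a b)) {x : ℝ}
    (hx : x ∈ Icc a b) :
    |doublePrimitive a b w x| ≤ (b - a) * ∫ t in Ioo a b, |w t| := by
  have h := abs_doublePrimitive_sub_le hw x a
  rw [doublePrimitive_left, sub_zero, abs_of_nonneg (sub_nonneg.2 hx.1)] at h
  refine h.trans (mul_le_mul_of_nonneg_right (by linarith [hx.2])
    (integral_nonneg fun _ => abs_nonneg _))

theorem doublePrimitive_eq_intervalIntegral (w : ℝ → ℝ) {x : ℝ} (hx : x ∈ Icc a b) :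
    doublePrimitive a b w x = ∫ t in a..x, (x - t) * w t := by
  unfold doublePrimitive
  rw [intervalIntegral.integral_of_le hx.1, ← integral_Ioc_eq_integral_Ioo,
    setIntegral_eq_of_subset_of_forall_sdiff_eq_zero measurableSet_Ioc
      (Ioc_subset_Ioc_right hx.2)]
  · refine setIntegral_congr_fun measurableSet_Ioc fun t ht => ?_
    simp only [max_eq_left (sub_nonneg.2 ht.2)]
  · intro t ht
    have : x < t := by
      by_contra! h
      exact ht.2 ⟨ht.1.1, h⟩
    rw [max_eq_right (by linarith), zero_mul]

theorem integrableOn_L2 (w : L2 a b) : IntegrableOn w (Ioo a b) :=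
  (Lp.memLp w).integrable (by norm_num)

theorem integral_abs_le_mul_norm (w : L2 a b) :
    ∫ t in Ioo a b, |w t| ≤ ‖Lp.const 2 (volume.restrict (Ioo a b)) (1 : ℝ)‖ * ‖w‖ := by
  have h : ∫ t in Ioo a b, |w t| =
      inner ℝ (Lp.const 2 (volume.restrict (Ioo a b)) (1 : ℝ)) |w| := by
    rw [L2.inner_def]
    refine integral_congr_ae ?_
    filter_upwards [Lp.coeFn_const (p := 2) (μ := volume.restrict (Ioo a b)) (1 : ℝ),
      Lp.coeFn_abs w] with t h1 h2
    rw [h1, h2]; simp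
  rw [h, ← norm_abs_eq_norm w]
  exact real_inner_le_norm _ _

theorem memLp_of_continuous {f : ℝ → ℝ} (hf : Continuous f) :
    MemLp f 2 (volume.restrict (Ioo a b)) := by
  obtain ⟨C, hC⟩ := (isCompact_Icc (a := a) (b := b)).exists_bound_of_continuousOn hf.continuousOn
  refine MemLp.of_bound hf.aestronglyMeasurable C ?_
  filter_upwards [ae_restrict_mem measurableSet_Ioo] with t ht
  exact hC t (Ioo_subset_Icc_self ht)

/-- The twofold primitive as an operator on `L²(a, b)`. -/
noncomputable def doublePrimitiveL2 (a b : ℝ) : L2 a b →L[ℝ] L2 a b :=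
  LinearMap.mkContinuous
    { toFun := fun w => (memLp_of_continuous (continuous_doublePrimitive (integrableOn_L2 w))).toLp
      map_add' := by
        intro v w
        rw [← MemLp.toLp_add]
        refine MemLp.toLp_congr _ _ (Eventually.of_forall fun x => ?_)
        rw [doublePrimitive_congr (Lp.coeFn_add v w),
          doublePrimitive_add (integrableOn_L2 v) (integrableOn_L2 w)]
        rfl
      map_smul' := by
        intro c w
        rw [RingHom.id_apply, ← MemLp.toLp_const_smul]
        refine MemLp.toLp_congr _ _ (Eventually.of_forall fun x => ?_)
        rw [doublePrimitive_congr (Lp.coeFn_smul c w), doublePrimitive_smul]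
        rfl }
    (‖Lp.const 2 (volume.restrict (Ioo a b)) (1 : ℝ)‖ * (|b - a| *
      ‖Lp.const 2 (volume.restrict (Ioo a b)) (1 : ℝ)‖)) (by
    intro w
    rw [mul_assoc]
    have h := Lp.norm_le_mul_norm_of_ae_le_mul
      (c := |b - a| * ‖Lp.const 2 (volume.restrict (Ioo a b)) (1 : ℝ)‖ * ‖w‖)
      (f := (memLp_of_continuous (continuous_doublePrimitive (integrableOn_L2 w))).toLp)
      (g := Lp.const 2 (volume.restrict (Ioo a b)) (1 : ℝ)) ?_
    · rw [mul_comm ‖Lp.const _ _ _‖]; exact h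
    filter_upwards [Lp.coeFn_const (p := 2) (μ := volume.restrict (Ioo a b)) (1 : ℝ),
      ae_restrict_mem measurableSet_Ioo, MemLp.coeFn_toLp (memLp_of_continuous (a := a) (b := b)
        (continuous_doublePrimitive (integrableOn_L2 w)))] with t h1 h2 h3
    rw [h1, h3, Real.norm_eq_abs, mul_assoc |b - a|]
    simp only [Function.const_apply, norm_one, mul_one]
    have hab : 0 ≤ b - a := by linarith [h2.1, h2.2]
    rw [abs_of_nonneg hab]
    exact (abs_doublePrimitive_le (integrableOn_L2 w) (Ioo_subset_Icc_self h2)).trans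
      (mul_le_mul_of_nonneg_left (integral_abs_le_mul_norm w) hab))

theorem coeFn_doublePrimitiveL2 (w : L2 a b) :
    doublePrimitiveL2 a b w =ᵐ[volume.restrict (Ioo a b)] doublePrimitive a b w :=
  MemLp.coeFn_toLp (memLp_of_continuous (continuous_doublePrimitive (integrableOn_L2 w)))

/-- The inclusion of `C[a, b]` into `L²(a, b)`. -/
noncomputable def continuousToL2 {a b : ℝ} (hab : a ≤ b) :
    BoundedContinuousFunction (Icc a b) ℝ →L[ℝ] L2 a b :=
  LinearMap.mkContinuous
    { toFun := fun f => (memLp_of_continuous (f := IccExtend hab f)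
        f.continuous.Icc_extend').toLp
      map_add' := fun f g => by
        rw [← MemLp.toLp_add]; rfl
      map_smul' := fun c f => by
        rw [RingHom.id_apply, ← MemLp.toLp_const_smul]; rfl }
    ‖Lp.const 2 (volume.restrict (Ioo a b)) (1 : ℝ)‖ (by
    intro f
    rw [mul_comm]
    refine Lp.norm_le_mul_norm_of_ae_le_mul ?_
    filter_upwards [Lp.coeFn_const (p := 2) (μ := volume.restrict (Ioo a b)) (1 : ℝ),
      MemLp.coeFn_toLp (memLp_of_continuous (a := a) (b := b) (f := IccExtend hab f)
        f.continuous.Icc_extend')] with t h1 h3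
    rw [h1]
    refine le_trans (le_of_eq (congrArg _ h3)) ?_
    simpa [IccExtend] using f.norm_coe_le_norm _)

/-- Images of the unit ball are uniformly bounded with a common Lipschitz constant, so Arzelà–Ascoli
applies in `C[a, b]`, which maps continuously into `L²`. -/
theorem isCompactOperator_doublePrimitiveL2 (hab : a ≤ b) :
    IsCompactOperator (doublePrimitiveL2 a b) := by
  set T : L2 a b → BoundedContinuousFunction (Icc a b) ℝ := fun w =>
    BoundedContinuousFunction.mkOfCompact
      ⟨fun x => doublePrimitive a b w x,
        (continuous_doublePrimitive (integrableOn_L2 w)).comp continuous_subtype_val⟩ with hT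
  set C := ‖Lp.const 2 (volume.restrict (Ioo a b)) (1 : ℝ)‖
  set A := T '' Metric.closedBall 0 1 with hA
  have hw1 : ∀ w : L2 a b, w ∈ Metric.closedBall 0 1 → ∫ t in Ioo a b, |w t| ≤ C := by
    intro w hw
    refine (integral_abs_le_mul_norm w).trans ?_
    have : ‖w‖ ≤ 1 := by simpa using hw
    exact mul_le_of_le_one_right (norm_nonneg _) this
  have hcomp : IsCompact (closure A) := by
    refine BoundedContinuousFunction.arzela_ascoli (Metric.closedBall 0 ((b - a) * C))
      (isCompact_closedBall _ _) A ?_ ?_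
    · rintro _ x ⟨w, hw, rfl⟩
      rw [mem_closedBall_zero_iff]
      exact (abs_doublePrimitive_le (integrableOn_L2 w) x.2).trans
        (mul_le_mul_of_nonneg_left (hw1 w hw) (sub_nonneg.2 hab))
    · refine (LipschitzWith.uniformEquicontinuous _ (Real.toNNReal C) ?_).equicontinuous
      rintro ⟨_, w, hw, rfl⟩
      refine LipschitzWith.of_dist_le_mul fun x y => ?_
      rw [Real.coe_toNNReal _ (norm_nonneg _), Real.dist_eq, mul_comm]
      exact (abs_doublePrimitive_sub_le (integrableOn_L2 w) x y).trans
        (mul_le_mul_of_nonneg_left (hw1 w hw) (abs_nonneg _))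
  refine (isCompactOperator_iff_image_closedBall_subset_compact (𝕜₁ := ℝ) (σ₁₂ := RingHom.id ℝ)
    (doublePrimitiveL2 a b : L2 a b →ₗ[ℝ] L2 a b) one_pos).2 ⟨continuousToL2 hab '' closure A, hcomp.image (continuousToL2 hab).continuous, ?_⟩
  rintro _ ⟨w, hw, rfl⟩
  refine ⟨T w, subset_closure ⟨w, hw, rfl⟩, ?_⟩
  refine MemLp.toLp_congr
    (memLp_of_continuous (f := IccExtend hab (T w)) (T w).continuous.Icc_extend')
    (memLp_of_continuous (continuous_doublePrimitive (integrableOn_L2 w))) ?_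
  filter_upwards [ae_restrict_mem measurableSet_Ioo] with t ht
  rw [IccExtend_of_mem _ _ (Ioo_subset_Icc_self ht)]
  rfl

end DoubleIntegral

theorem integral_Ioo_eq_intervalIntegral {a b : ℝ} (hab : a ≤ b) (f : ℝ → ℝ) :
    ∫ x in Ioo a b, f x = ∫ x in a..b, f x := by
  rw [intervalIntegral.integral_of_le hab, integral_Ioc_eq_integral_Ioo]

/-! ### Test functions and distributional second derivatives -/

namespace IsTestFunction

variable {a b : ℝ} {φ ψ : ℝ → ℝ}

theorem sub (hφ : IsTestFunction a b φ) (hψ : IsTestFunction a b ψ) :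
    IsTestFunction a b (φ - ψ) :=
  ⟨hφ.smooth.sub hψ.smooth, by simpa [sub_eq_add_neg] using hφ.compact.add hψ.compact.neg,
    (tsupport_sub φ ψ).trans (union_subset hφ.support hψ.support)⟩

theorem smul (hφ : IsTestFunction a b φ) (c : ℝ) : IsTestFunction a b (c • φ) :=
  ⟨contDiff_const.smul hφ.smooth, hφ.compact.smul_left (f := fun _ => c),
    (closure_mono (Function.support_const_smul_subset c φ)).trans hφ.support⟩

theorem deriv (hφ : IsTestFunction a b φ) : IsTestFunction a b (deriv φ) :=
  ⟨(contDiff_infty_iff_deriv.1 hφ.smooth).2, hφ.compact.deriv,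
    (closure_minimal support_deriv_subset (isClosed_tsupport φ)).trans hφ.support⟩

theorem eq_zero (hφ : IsTestFunction a b φ) {x : ℝ} (hx : x ∉ Ioo a b) : φ x = 0 :=
  image_eq_zero_of_notMem_tsupport fun h => hx (hφ.support h)

theorem left (hφ : IsTestFunction a b φ) : φ a = 0 := hφ.eq_zero (by simp)

theorem right (hφ : IsTestFunction a b φ) : φ b = 0 := hφ.eq_zero (by simp)

theorem hasDerivAt (hφ : IsTestFunction a b φ) (x : ℝ) : HasDerivAt φ (_root_.deriv φ x) x :=
  (hφ.smooth.differentiable (by simp) x).hasDerivAt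

theorem integrableOn (hφ : IsTestFunction a b φ) : IntegrableOn φ (Ioo a b) :=
  (hφ.smooth.continuous.integrable_of_hasCompactSupport hφ.compact).integrableOn

theorem memLp (hφ : IsTestFunction a b φ) : MemLp φ 2 (volume.restrict (Ioo a b)) :=
  memLp_of_continuous hφ.smooth.continuous

theorem integrableOn_mul (hφ : IsTestFunction a b φ) {f : ℝ → ℝ} (hf : IntegrableOn f (Ioo a b)) :
    IntegrableOn (fun x => f x * φ x) (Ioo a b) := by
  obtain ⟨C, hC⟩ := hφ.compact.exists_bound_of_continuous hφ.smooth.continuous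
  exact hf.mul_bdd (c := C) hφ.smooth.continuous.aestronglyMeasurable (Eventually.of_forall hC)

theorem iteratedDeriv_two (φ : ℝ → ℝ) : iteratedDeriv 2 φ = _root_.deriv (_root_.deriv φ) := by
  rw [iteratedDeriv_succ, iteratedDeriv_one]

theorem integral_deriv (hab : a ≤ b) (hφ : IsTestFunction a b φ) :
    ∫ x in Ioo a b, _root_.deriv φ x = 0 := by
  rw [integral_Ioo_eq_intervalIntegral hab,
    intervalIntegral.integral_eq_sub_of_hasDerivAt (fun x _ => hφ.hasDerivAt x)
      (hφ.deriv.smooth.continuous.intervalIntegrable _ _), hφ.left, hφ.right, sub_zero]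

theorem doublePrimitive_deriv_deriv (hφ : IsTestFunction a b φ) {x : ℝ} (hx : x ∈ Icc a b) :
    doublePrimitive a b (_root_.deriv (_root_.deriv φ)) x = φ x := by
  rw [doublePrimitive_eq_intervalIntegral _ hx]
  have hd : ∀ t ∈ uIcc a x, HasDerivAt (fun t => (x - t) * _root_.deriv φ t + φ t)
      ((x - t) * _root_.deriv (_root_.deriv φ) t) t := by
    intro t _
    have h := (((hasDerivAt_id t).const_sub x).mul (hφ.deriv.hasDerivAt t)).add (hφ.hasDerivAt t)
    exact h.congr_deriv (by simp only [id]; ring)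
  have hc := hφ.deriv.deriv.smooth.continuous
  rw [intervalIntegral.integral_eq_sub_of_hasDerivAt hd
    ((by fun_prop : Continuous _).intervalIntegrable _ _)]
  simp [hφ.left, hφ.deriv.left]

theorem integral_kernel_mul_deriv_deriv (hφ : IsTestFunction a b φ) {t : ℝ} (ht : t ∈ Icc a b) :
    ∫ x in Ioo a b, max (x - t) 0 * _root_.deriv (_root_.deriv φ) x = φ t := by
  have hd : ∀ x ∈ uIcc t b, HasDerivAt (fun x => (x - t) * _root_.deriv φ x - φ x)
      ((x - t) * _root_.deriv (_root_.deriv φ) x) x := by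
    intro x _
    have h := (((hasDerivAt_id x).sub_const t).mul (hφ.deriv.hasDerivAt x)).sub (hφ.hasDerivAt x)
    exact h.congr_deriv (by simp only [id]; ring)
  have hc := hφ.deriv.deriv.smooth.continuous
  have h1 : ∫ x in Ioo a b, max (x - t) 0 * _root_.deriv (_root_.deriv φ) x
      = ∫ x in t..b, (x - t) * _root_.deriv (_root_.deriv φ) x := by
    rw [intervalIntegral.integral_of_le ht.2, ← integral_Ioc_eq_integral_Ioo,
      setIntegral_eq_of_subset_of_forall_sdiff_eq_zero measurableSet_Ioc
        (Ioc_subset_Ioc_left ht.1)]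
    · refine setIntegral_congr_fun measurableSet_Ioc fun x hx => ?_
      simp only [max_eq_left (sub_nonneg.2 hx.1.le)]
    · intro x hx
      have : x ≤ t := by
        by_contra! h
        exact hx.2 ⟨h, hx.1.2⟩
      rw [max_eq_right (by linarith), zero_mul]
  rw [h1, intervalIntegral.integral_eq_sub_of_hasDerivAt hd
    ((by fun_prop : Continuous _).intervalIntegrable _ _)]
  simp [hφ.right, hφ.deriv.right]

/-- By Fubini the kernel may be integrated first against `φ''`, which returns `φ`. Thus the twofold
primitive is a second antiderivative in the sense of distributions. -/
theorem integral_doublePrimitive_mul_deriv_deriv (hφ : IsTestFunction a b φ) {u : ℝ → ℝ}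
    (hu : IntegrableOn u (Ioo a b)) :
    ∫ x in Ioo a b, doublePrimitive a b u x * _root_.deriv (_root_.deriv φ) x
      = ∫ x in Ioo a b, u x * φ x := by
  set ψ := _root_.deriv (_root_.deriv φ) with hψ
  have hint : Integrable (Function.uncurry fun x t => max (x - t) 0 * (ψ x * u t))
      ((volume.restrict (Ioo a b)).prod (volume.restrict (Ioo a b))) := by
    have h1 : Integrable (fun p : ℝ × ℝ => ψ p.1 * u p.2)
        ((volume.restrict (Ioo a b)).prod (volume.restrict (Ioo a b))) :=
      Integrable.mul_prod hφ.deriv.deriv.integrableOn hu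
    refine Integrable.bdd_mul (c := b - a) h1 (by fun_prop) ?_
    rw [Measure.prod_restrict]
    filter_upwards [ae_restrict_mem (measurableSet_Ioo.prod measurableSet_Ioo)] with p hp
    rw [Real.norm_eq_abs, abs_of_nonneg (le_max_right _ _)]
    exact max_le (by linarith [hp.1.2, hp.2.1]) (by linarith [hp.1.1, hp.1.2])
  calc ∫ x in Ioo a b, doublePrimitive a b u x * ψ x
      = ∫ x in Ioo a b, ∫ t in Ioo a b, max (x - t) 0 * (ψ x * u t) := by
        refine integral_congr_ae (Eventually.of_forall fun x => ?_)
        simp only [doublePrimitive]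
        rw [← integral_mul_const]
        refine integral_congr_ae (Eventually.of_forall fun t => ?_)
        ring
    _ = ∫ t in Ioo a b, ∫ x in Ioo a b, max (x - t) 0 * (ψ x * u t) := integral_integral_swap hint
    _ = ∫ t in Ioo a b, u t * φ t := by
        refine setIntegral_congr_fun measurableSet_Ioo fun t ht => ?_
        rw [← hφ.integral_kernel_mul_deriv_deriv (Ioo_subset_Icc_self ht), ← integral_const_mul]
        refine integral_congr_ae (Eventually.of_forall fun x => ?_)
        simp only [← hψ]; ring

theorem exists_Icc_of_isCompact (hab : a < b) {K : Set ℝ} (hK : IsCompact K) (h : K ⊆ Ioo a b) :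
    ∃ c d, a < c ∧ d < b ∧ K ⊆ Icc c d := by
  rcases K.eq_empty_or_nonempty with rfl | hne
  -- Reversed endpoints satisfy both strict inequalities when there is nothing to cover.
  · exact ⟨b, a, hab, hab, empty_subset _⟩
  · exact ⟨sInf K, sSup K, (h (hK.sInf_mem hne)).1, (h (hK.sSup_mem hne)).2,
      fun x hx => ⟨csInf_le hK.bddBelow hx, le_csSup hK.bddAbove hx⟩⟩

/-- The primitive from `a` vanishes to the left of the support of `ψ`; zero mean makes it vanish to
the right too. -/
theorem exists_deriv_eq (hab : a < b) (hψ : IsTestFunction a b ψ)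
    (h0 : ∫ x in Ioo a b, ψ x = 0) : ∃ χ, IsTestFunction a b χ ∧ _root_.deriv χ = ψ := by
  obtain ⟨c, d, hc, hd, hK⟩ := exists_Icc_of_isCompact hab hψ.compact hψ.support
  have hψc := hψ.smooth.continuous
  set χ : ℝ → ℝ := fun x => ∫ t in a..x, ψ t with hχ
  have hder : ∀ x, HasDerivAt χ (ψ x) x := fun x =>
    intervalIntegral.integral_hasDerivAt_right (hψc.intervalIntegrable _ _)
      (hψc.stronglyMeasurableAtFilter _ _) hψc.continuousAt
  have hderiv : _root_.deriv χ = ψ := funext fun x => (hder x).deriv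
  have hz : ∀ t, t ∉ Icc c d → ψ t = 0 := fun t ht =>
    image_eq_zero_of_notMem_tsupport fun h => ht (hK h)
  have hχz : ∀ x, x ∉ Icc c d → χ x = 0 := by
    intro x hx
    rcases lt_or_ge x c with h | h
    · refine intervalIntegral.integral_zero_ae (Eventually.of_forall fun t ht => hz t fun h' => ?_)
      have := ht.2.trans (sup_le hc.le h.le)
      rcases le_total a x with h2 | h2
      · rw [uIoc_of_le h2] at ht; linarith [ht.2, h'.1]
      · rw [uIoc_of_ge h2] at ht; linarith [ht.2, h'.1]
    · have hxd : d < x := by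
        by_contra! h2
        exact hx ⟨h, h2⟩
      have : χ x = (∫ t in a..b, ψ t) + ∫ t in b..x, ψ t :=
        (intervalIntegral.integral_add_adjacent_intervals (hψc.intervalIntegrable _ _)
          (hψc.intervalIntegrable _ _)).symm
      rw [this, ← integral_Ioo_eq_intervalIntegral hab.le, h0, zero_add]
      refine intervalIntegral.integral_zero_ae (Eventually.of_forall fun t ht => hz t fun h' => ?_)
      rcases le_total b x with h2 | h2
      · rw [uIoc_of_le h2] at ht; linarith [ht.1, h'.2]
      · rw [uIoc_of_ge h2] at ht; linarith [ht.1, h'.2]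
  refine ⟨χ, ⟨?_, HasCompactSupport.intro isCompact_Icc hχz, ?_⟩, hderiv⟩
  · rw [contDiff_infty_iff_deriv, hderiv]
    exact ⟨fun x => (hder x).differentiableAt, hψ.smooth⟩
  · refine (closure_minimal (fun x hx => ?_) isClosed_Icc).trans
      (fun x (hx : x ∈ Icc c d) => ⟨hc.trans_le hx.1, hx.2.trans_lt hd⟩)
    by_contra h
    exact hx (hχz x h)

theorem exists_integral_eq_one (hab : a < b) :
    ∃ η, IsTestFunction a b η ∧ ∫ x in Ioo a b, η x = 1 := by
  let f : ContDiffBump ((a + b) / 2) := ⟨(b - a) / 8, (b - a) / 4, by linarith, by linarith⟩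
  have hη : IsTestFunction a b (f.normed volume) := by
    refine ⟨f.contDiff_normed, f.hasCompactSupport_normed, ?_⟩
    rw [f.tsupport_normed_eq, Real.closedBall_eq_Icc]
    intro x hx
    simp only [f, mem_Icc] at hx
    constructor <;> linarith [hx.1, hx.2]
  refine ⟨_, hη, ?_⟩
  rw [setIntegral_eq_integral_of_forall_compl_eq_zero fun x hx => hη.eq_zero hx, f.integral_normed]

/-- A function whose second distributional derivative vanishes is affine. -/
theorem ae_eq_affine_of_integral_mul_deriv_deriv_eq_zero (hab : a < b) {f : ℝ → ℝ}
    (hf : IntegrableOn f (Ioo a b))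
    (h : ∀ φ, IsTestFunction a b φ →
      ∫ x in Ioo a b, f x * _root_.deriv (_root_.deriv φ) x = 0) :
    ∃ α β : ℝ, f =ᵐ[volume.restrict (Ioo a b)] fun x => α + β * x := by
  obtain ⟨η, hη, hη1⟩ := exists_integral_eq_one hab
  set c₀ := ∫ x in Ioo a b, f x * η x with hc₀
  set c₁ := ∫ x in Ioo a b, f x * _root_.deriv η x with hc₁
  set m := ∫ x in Ioo a b, x * η x with hm
  have hid : IntegrableOn (fun x : ℝ => x) (Ioo a b) :=
    (continuous_id.integrableOn_Icc (a := a) (b := b)).mono_set Ioo_subset_Icc_self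
  have hone : IntegrableOn (fun _ : ℝ => (1 : ℝ)) (Ioo a b) :=
    (continuous_const.integrableOn_Icc (a := a) (b := b)).mono_set Ioo_subset_Icc_self
  -- Any `ψ` becomes a second derivative after two corrections: subtract `A η` to get mean zero and
  -- integrate to `χ`, then subtract `B η` and integrate to `φ`. The costs of the corrections are
  -- `c₀` and `c₁`, and integrating `x χ'` by parts expresses `B` through `∫ x ψ`, which produces
  -- the linear term.
  have key : ∀ ψ, IsTestFunction a b ψ →
      ∫ x in Ioo a b, (f x - (c₀ + c₁ * m + -c₁ * x)) * ψ x = 0 := by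
    intro ψ hψ
    set A := ∫ x in Ioo a b, ψ x with hA
    have h1 : IsTestFunction a b (ψ - A • η) := hψ.sub (hη.smul A)
    obtain ⟨χ, hχ, hχ'⟩ := exists_deriv_eq hab h1 (by
      simp only [Pi.sub_apply, Pi.smul_apply, smul_eq_mul]
      rw [integral_sub hψ.integrableOn (hη.integrableOn.const_mul A), integral_const_mul, hη1]
      simp [hA])
    set B := ∫ x in Ioo a b, χ x with hB
    obtain ⟨φ, hφ, hφ'⟩ := exists_deriv_eq hab (hχ.sub (hη.smul B)) (by
      simp only [Pi.sub_apply, Pi.smul_apply, smul_eq_mul]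
      rw [integral_sub hχ.integrableOn (hη.integrableOn.const_mul B), integral_const_mul, hη1]
      simp [hB])
    have hφ2 : ∀ x, _root_.deriv (_root_.deriv φ) x
        = ψ x - A * η x - B * _root_.deriv η x := by
      intro x
      rw [hφ']
      have := ((hχ.hasDerivAt x).sub ((hη.hasDerivAt x).const_smul B)).deriv
      rw [this, hχ']
      simp
    have hBval : B = A * m - ∫ x in Ioo a b, x * ψ x := by
      have hxχ : ∫ x in Ioo a b, (χ x + x * _root_.deriv χ x) = 0 := by
        rw [integral_Ioo_eq_intervalIntegral hab.le,
          intervalIntegral.integral_eq_sub_of_hasDerivAt (f := fun x => x * χ x)]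
        · simp [hχ.left, hχ.right]
        · intro x _
          exact ((hasDerivAt_id x).mul (hχ.hasDerivAt x)).congr_deriv (by simp)
        · have h1 := hχ.smooth.continuous
          have h2 := hχ.deriv.smooth.continuous
          exact (by fun_prop : Continuous _).intervalIntegrable _ _
      rw [integral_add hχ.integrableOn (hχ.deriv.integrableOn_mul hid), ← hB] at hxχ
      have : ∫ x in Ioo a b, x * _root_.deriv χ x = (∫ x in Ioo a b, x * ψ x) - A * m := by
        rw [hm, ← integral_const_mul, ← integral_sub (hψ.integrableOn_mul hid)
          ((hη.integrableOn_mul hid).const_mul A)]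
        refine integral_congr_ae (Eventually.of_forall fun x => ?_)
        simp only [hχ', Pi.sub_apply, Pi.smul_apply, smul_eq_mul]; ring
      linarith
    have h2 := h φ hφ
    have h3 : ∫ x in Ioo a b, f x * _root_.deriv (_root_.deriv φ) x
        = (∫ x in Ioo a b, f x * ψ x) - A * c₀ - B * c₁ := by
      have hi : IntegrableOn (fun x => f x * ψ x - A * (f x * η x)) (Ioo a b) :=
        (hψ.integrableOn_mul hf).sub ((hη.integrableOn_mul hf).const_mul A)
      rw [hc₀, hc₁, ← integral_const_mul, ← integral_const_mul,
        ← integral_sub (hψ.integrableOn_mul hf) ((hη.integrableOn_mul hf).const_mul A),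
        ← integral_sub hi ((hη.deriv.integrableOn_mul hf).const_mul B)]
      refine integral_congr_ae (Eventually.of_forall fun x => ?_)
      simp only [hφ2]; ring
    have h4 : ∫ x in Ioo a b, (f x - (c₀ + c₁ * m + -c₁ * x)) * ψ x
        = (∫ x in Ioo a b, f x * ψ x) - (c₀ + c₁ * m) * A + c₁ * ∫ x in Ioo a b, x * ψ x := by
      have hi : IntegrableOn (fun x => f x * ψ x - (c₀ + c₁ * m) * ψ x) (Ioo a b) :=
        (hψ.integrableOn_mul hf).sub (hψ.integrableOn.const_mul _)
      rw [hA, ← integral_const_mul (c₀ + c₁ * m), ← integral_const_mul c₁ (fun x => x * ψ x),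
        ← integral_sub (hψ.integrableOn_mul hf) (hψ.integrableOn.const_mul _),
        ← integral_add hi ((hψ.integrableOn_mul hid).const_mul _)]
      refine integral_congr_ae (Eventually.of_forall fun x => ?_)
      simp only; ring
    rw [h4]
    rw [h3, hBval] at h2
    linarith
  refine ⟨c₀ + c₁ * m, -c₁, ?_⟩
  have hg : IntegrableOn (fun x => f x - (c₀ + c₁ * m + -c₁ * x)) (Ioo a b) :=
    hf.sub (((hone.const_mul (c₀ + c₁ * m)).congr (by simp)).add (hid.const_mul (-c₁)))
  have := isOpen_Ioo.ae_eq_zero_of_integral_contDiff_smul_eq_zero (μ := volume)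
    hg.locallyIntegrableOn (fun ψ hs hcpt hsupp => by
      have hψ : IsTestFunction a b ψ := ⟨hs, hcpt, hsupp⟩
      rw [← key ψ hψ, setIntegral_eq_integral_of_forall_compl_eq_zero]
      · exact integral_congr_ae (Eventually.of_forall fun x => by simp [mul_comm])
      · intro x hx; rw [hψ.eq_zero hx, mul_zero])
  rw [EventuallyEq, ae_restrict_iff' measurableSet_Ioo]
  filter_upwards [this] with x hx hxm
  have := hx hxm
  linarith

end IsTestFunction

/-! ### Weighted forms on `L²` -/

section WeightedForms

variable {a b : ℝ}

/-- Multiplication by an essentially bounded function on `L²(a, b)`. -/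
theorem exists_mul_operator {κ : ℝ → ℝ} (hκ : AEStronglyMeasurable κ (volume.restrict (Ioo a b)))
    {M : ℝ} (hM : ∀ᵐ x ∂volume.restrict (Ioo a b), |κ x| ≤ M) :
    ∃ T : L2 a b →L[ℝ] L2 a b, ∀ w, T w =ᵐ[volume.restrict (Ioo a b)] fun x => κ x * w x := by
  have hbd : ∀ w : L2 a b, ∀ᵐ x ∂volume.restrict (Ioo a b), ‖κ x * w x‖ ≤ M * ‖w x‖ := fun w =>
    hM.mono fun x hx => by
      rw [norm_mul]; exact mul_le_mul_of_nonneg_right hx (norm_nonneg _)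
  have hmem : ∀ w : L2 a b, MemLp (fun x => κ x * w x) 2 (volume.restrict (Ioo a b)) := fun w =>
    (Lp.memLp w).of_le_mul (hκ.mul (Lp.aestronglyMeasurable w)) (hbd w)
  refine ⟨LinearMap.mkContinuous
    { toFun := fun w => (hmem w).toLp
      map_add' := fun v w => by
        rw [← MemLp.toLp_add]
        refine MemLp.toLp_congr _ _ ?_
        filter_upwards [Lp.coeFn_add v w] with x hx
        simp only [hx, Pi.add_apply, mul_add]
      map_smul' := fun c w => by
        rw [RingHom.id_apply, ← MemLp.toLp_const_smul]
        refine MemLp.toLp_congr _ _ ?_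
        filter_upwards [Lp.coeFn_smul c w] with x hx
        simp only [hx, Pi.smul_apply, smul_eq_mul]; ring } M fun w => ?_,
    fun w => MemLp.coeFn_toLp (hmem w)⟩
  refine Lp.norm_le_mul_norm_of_ae_le_mul ?_
  filter_upwards [hbd w, MemLp.coeFn_toLp (hmem w)] with x h1 h2
  exact (le_of_eq (congrArg _ h2)).trans h1

theorem aestronglyMeasurable_indicator_of_continuousOn {s : Set ℝ} (hs : MeasurableSet s)
    {k : ℝ → ℝ} (hk : ContinuousOn k s) (μ : Measure ℝ) :
    AEStronglyMeasurable (s.indicator k) μ :=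
  (aestronglyMeasurable_indicator_iff hs).2 (hk.aestronglyMeasurable hs)

/-- The weighted form `∫_s k v w` is bounded on `L²(a, b)`. -/
theorem exists_weighted_form {s : Set ℝ} (hs : MeasurableSet s) (hsub : s ⊆ Ioo a b) {k : ℝ → ℝ}
    (hk : ContinuousOn k s) {M : ℝ} (hM : ∀ x ∈ s, |k x| ≤ M) :
    ∃ D : L2 a b →L[ℝ] L2 a b →L[ℝ] ℝ, ∀ v w, D v w = ∫ x in s, k x * v x * w x := by
  obtain ⟨T, hT⟩ := exists_mul_operator (a := a) (b := b) (M := max M 0)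
    (aestronglyMeasurable_indicator_of_continuousOn hs hk _) (Eventually.of_forall fun x => by
      by_cases hx : x ∈ s
      · rw [indicator_of_mem hx]; exact (hM x hx).trans (le_max_left _ _)
      · rw [indicator_of_notMem hx]; simp)
  refine ⟨LinearMap.mkContinuous₂ (LinearMap.mk₂ ℝ (fun v w => inner ℝ (T v) w)
    (fun u v w => by rw [map_add, inner_add_left])
    (fun c v w => by rw [map_smul, real_inner_smul_left]; rfl)
    (fun u v w => inner_add_right _ _ _)
    (fun c v w => real_inner_smul_right _ _ _)) ‖T‖ fun v w => ?_, fun v w => ?_⟩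
  · exact (norm_inner_le_norm _ _).trans
      (mul_le_mul_of_nonneg_right (T.le_opNorm v) (norm_nonneg _))
  · change inner ℝ (T v) w = _
    rw [L2.inner_def]
    have : ∫ x in s, k x * v x * w x
        = ∫ x in Ioo a b, s.indicator (fun x => k x * v x * w x) x := by
      rw [setIntegral_indicator hs, inter_eq_right.2 hsub]
    rw [this]
    refine integral_congr_ae ((hT v).mono fun x hx => ?_)
    simp only [hx]
    by_cases h : x ∈ s <;> simp [h, mul_comm]

theorem integral_Ioo_add_adjacent {c : ℝ} (hac : a ≤ c) (hcb : c ≤ b) {f : ℝ → ℝ}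
    (hf : IntegrableOn f (Ioo a b)) :
    ∫ x in Ioo a b, f x = (∫ x in Ioo a c, f x) + ∫ x in Ioo c b, f x := by
  rw [integral_Ioo_eq_intervalIntegral (hac.trans hcb), integral_Ioo_eq_intervalIntegral hac,
    integral_Ioo_eq_intervalIntegral hcb]
  refine (intervalIntegral.integral_add_adjacent_intervals ?_ ?_).symm
  · rw [intervalIntegrable_iff_integrableOn_Ioo_of_le hac]
    exact hf.mono_set (Ioo_subset_Ioo_right hcb)
  · rw [intervalIntegrable_iff_integrableOn_Ioo_of_le hcb]
    exact hf.mono_set (Ioo_subset_Ioo_left hac)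

theorem integrableOn_sq (w : L2 a b) : IntegrableOn (fun x => w x * w x) (Ioo a b) :=
  (L2.integrable_inner (𝕜 := ℝ) w w).congr (Eventually.of_forall fun x => by simp [sq])

theorem norm_sq_eq_integral (w : L2 a b) : ‖w‖ ^ 2 = ∫ x in Ioo a b, w x * w x := by
  rw [← real_inner_self_eq_norm_sq, L2.inner_def]
  exact integral_congr_ae (Eventually.of_forall fun x => by simp [sq])

theorem mul_integral_sq_le_weighted {s : Set ℝ} (hs : MeasurableSet s) (hsub : s ⊆ Ioo a b)
    {k : ℝ → ℝ} (hk : ContinuousOn k s) {m M : ℝ} (hm : 0 < m)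
    (hmM : ∀ x ∈ s, m ≤ k x ∧ k x ≤ M) (w : L2 a b) :
    m * ∫ x in s, w x * w x ≤ ∫ x in s, k x * w x * w x := by
  have hi := (integrableOn_sq w).mono_set hsub
  rw [← integral_const_mul]
  refine setIntegral_mono_on (hi.const_mul m) ?_ hs fun x hx => ?_
  · have : IntegrableOn (fun x => k x * (w x * w x)) s := by
      refine Integrable.bdd_mul (c := M) hi (hk.aestronglyMeasurable hs) ?_
      filter_upwards [ae_restrict_mem hs] with x hx
      rw [Real.norm_eq_abs, abs_of_pos (hm.trans_le (hmM x hx).1)]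
      exact (hmM x hx).2
    exact this.congr (Eventually.of_forall fun x => by simp only; ring)
  · rw [mul_assoc]
    exact mul_le_mul_of_nonneg_right (hmM x hx).1 (mul_self_nonneg _)

end WeightedForms

/-! ### Grönwall's inequality and propagation of sign -/

section Positivity

variable {a b : ℝ}

theorem doublePrimitive_le_mul_intervalIntegral {g : ℝ → ℝ} (hg : Continuous g)
    (h0 : ∀ x, a ≤ x → 0 ≤ g x) {x : ℝ} (hx : x ∈ Icc a b) :
    doublePrimitive a b g x ≤ (b - a) * ∫ t in a..x, g t := by
  rw [doublePrimitive_eq_intervalIntegral _ hx, ← intervalIntegral.integral_const_mul]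
  refine intervalIntegral.integral_mono_on hx.1
    ((by fun_prop : Continuous _).intervalIntegrable _ _)
    ((by fun_prop : Continuous _).intervalIntegrable _ _) fun t ht => ?_
  exact mul_le_mul_of_nonneg_right (by linarith [ht.1, hx.2]) (h0 t ht.1)

/-- A Grönwall inequality in integral form. -/
theorem nonpos_of_le_mul_integral {n : ℝ → ℝ} (hn : Continuous n) {C : ℝ} (hC : 0 ≤ C)
    (h : ∀ x ∈ Icc a b, n x ≤ C * ∫ t in a..x, n t) {x : ℝ} (hx : x ∈ Icc a b) : n x ≤ 0 := by
  -- The hypothesis reads `F' ≤ C F` with `F a = 0`, so `F x * exp (-(C x))` is nonincreasing from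
  -- `0`.
  set F : ℝ → ℝ := fun x => ∫ t in a..x, n t with hF
  have hder : ∀ x, HasDerivAt F (n x) x := fun x =>
    intervalIntegral.integral_hasDerivAt_right (hn.intervalIntegrable _ _)
      (hn.stronglyMeasurableAtFilter _ _) hn.continuousAt
  have hg : ∀ x, HasDerivAt (fun x => F x * Real.exp (-(C * x)))
      ((n x - C * F x) * Real.exp (-(C * x))) x := by
    intro x
    have h2 : HasDerivAt (fun x => Real.exp (-(C * x))) (Real.exp (-(C * x)) * (-(C * 1))) x :=
      (((hasDerivAt_id x).const_mul C).neg).exp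
    exact ((hder x).mul h2).congr_deriv (by ring)
  have hanti : AntitoneOn (fun x => F x * Real.exp (-(C * x))) (Icc a b) := by
    refine antitoneOn_of_deriv_nonpos (convex_Icc a b)
      (fun x _ => (hg x).continuousAt.continuousWithinAt)
      (fun x _ => (hg x).differentiableAt.differentiableWithinAt) fun x hx => ?_
    rw [interior_Icc] at hx
    rw [(hg x).deriv]
    exact mul_nonpos_of_nonpos_of_nonneg (by linarith [h x (Ioo_subset_Icc_self hx)])
      (Real.exp_pos _).le
  have h1 := hanti (left_mem_Icc.2 (hx.1.trans hx.2)) hx hx.1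
  have hFa : F a = 0 := by simp [hF]
  simp only [hFa, zero_mul] at h1
  have h2 : F x ≤ 0 := by
    by_contra! h3
    exact absurd (mul_pos h3 (Real.exp_pos _)) (not_lt.2 h1)
  exact (h x hx).trans (mul_nonpos_of_nonneg_of_nonpos hC h2)

/-- Propagation of sign for `(κ u'')'' = μ u` with `u(a) = u'(a) = (κ u'')(a) = 0`: if moreover
`w = u''` has mean zero, that is `u'(b) = 0`, then `w = 0`. -/
theorem ae_eq_zero_of_mul_eq_linear_add {κ w : ℝ → ℝ} {m β μ : ℝ} (hm : 0 < m) (hμ : 0 ≤ μ)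
    (hβ : 0 ≤ β) (hκ : ∀ᵐ x ∂volume.restrict (Ioo a b), m ≤ κ x) (hw : IntegrableOn w (Ioo a b))
    (h0 : ∫ x in Ioo a b, w x = 0)
    (h : ∀ᵐ x ∂volume.restrict (Ioo a b), κ x * w x =
      β * (x - a) + μ * doublePrimitive a b (doublePrimitive a b w) x) :
    w =ᵐ[volume.restrict (Ioo a b)] 0 := by
  have hint : ∀ {g : ℝ → ℝ}, Continuous g → IntegrableOn g (Ioo a b) := fun hg =>
    hg.integrableOn_Icc.mono_set Ioo_subset_Icc_self
  have hDw := continuous_doublePrimitive hw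
  have hDDw := continuous_doublePrimitive (hint hDw)
  set M : ℝ → ℝ := fun x => β * (x - a) + μ * doublePrimitive a b (doublePrimitive a b w) x
    with hM
  have hMc : Continuous M := by fun_prop
  set n : ℝ → ℝ := fun x => max (-M x) 0 with hn
  have hnc : Continuous n := by fun_prop
  have hn0 : ∀ x, 0 ≤ n x := fun x => le_max_right _ _
  set F : ℝ → ℝ := fun x => ∫ t in a..x, n t with hF
  have hFc : Continuous F := intervalIntegral.continuous_primitive
    (fun _ _ => hnc.intervalIntegrable _ _) a
  have hFmono : ∀ x y, x ≤ y → F x ≤ F y := by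
    intro x y hxy
    have h1 : F y - F x = ∫ t in x..y, n t :=
      intervalIntegral.integral_interval_sub_left (hnc.intervalIntegrable _ _)
        (hnc.intervalIntegrable _ _)
    have h2 : 0 ≤ ∫ t in x..y, n t := intervalIntegral.integral_nonneg hxy fun t _ => hn0 t
    linarith
  have hF0 : ∀ x, a ≤ x → 0 ≤ F x := fun x hx => intervalIntegral.integral_nonneg hx
    fun t _ => hn0 t
  -- Here `n` is the negative part of the moment `M = κ w`. Since `κ ≥ m`, a negative `w` cannot lie
  -- below `-n / m`; integrating this twice bounds `n` by a multiple of its own integral `F`.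
  have hwlow : (-(1 / m)) • n ≤ᵐ[volume.restrict (Ioo a b)] w := by
    filter_upwards [hκ, h] with x hk hx
    simp only [Pi.smul_apply, smul_eq_mul]
    have h1 : -n x ≤ κ x * w x := by rw [hx]; linarith [le_max_left (-M x) 0]
    have hkp : 0 < κ x := hm.trans_le hk
    by_contra! hlt
    have h2 : m * w x < -n x := by
      have := mul_lt_mul_of_pos_left hlt hm
      have e : m * (-(1 / m) * n x) = -n x := by field_simp
      linarith
    have h3 : w x < 0 := by
      by_contra! h4
      have := mul_nonneg hm.le h4
      linarith [hn0 x]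
    have h4 := mul_le_mul_of_nonpos_right hk h3.le
    linarith
  have hDlow : ∀ x, -(1 / m) * doublePrimitive a b n x ≤ doublePrimitive a b w x := fun x => by
    rw [← doublePrimitive_smul]
    exact doublePrimitive_mono (by exact (hint hnc).smul (-(1 / m))) hw hwlow x
  have hDDlow : ∀ x ∈ Icc a b, -(1 / m * (b - a) * ((b - a) * ((b - a) * F x))) ≤
      doublePrimitive a b (doublePrimitive a b w) x := by
    intro x hx
    have hab : 0 ≤ b - a := by linarith [hx.1, hx.2]
    have h1 : doublePrimitive a b ((-(1 / m * (b - a))) • F) x ≤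
        doublePrimitive a b (doublePrimitive a b w) x := by
      refine doublePrimitive_mono ((hint hFc).smul (-(1 / m * (b - a)))) (hint hDw) ?_ x
      filter_upwards [ae_restrict_mem measurableSet_Ioo] with t ht
      refine le_trans ?_ (hDlow t)
      have h2 := doublePrimitive_le_mul_intervalIntegral (b := b) hnc (fun x _ => hn0 x)
        (Ioo_subset_Icc_self ht)
      have h3 := mul_le_mul_of_nonneg_left h2 (by positivity : 0 ≤ 1 / m)
      simp only [Pi.smul_apply, smul_eq_mul, hF]
      linarith
    rw [doublePrimitive_smul] at h1
    refine le_trans ?_ h1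
    have h2 := doublePrimitive_le_mul_intervalIntegral (b := b) hFc hF0 hx
    have h3 : ∫ t in a..x, F t ≤ (b - a) * F x := by
      have h4 : ∫ t in a..x, F t ≤ ∫ _ in a..x, F x :=
        intervalIntegral.integral_mono_on hx.1 (hFc.intervalIntegrable _ _)
          (continuous_const.intervalIntegrable _ _) fun t ht => hFmono t x ht.2
      rw [intervalIntegral.integral_const, smul_eq_mul] at h4
      exact h4.trans (mul_le_mul_of_nonneg_right (by linarith [hx.2]) (hF0 x hx.1))
    have h5 := h2.trans (mul_le_mul_of_nonneg_left h3 hab)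
    have h6 := mul_le_mul_of_nonneg_left h5 (by positivity : 0 ≤ 1 / m * (b - a))
    linarith
  have hnz : ∀ x ∈ Icc a b, n x ≤ 0 := by
    intro x hx
    have hab : 0 ≤ b - a := by linarith [hx.1, hx.2]
    refine nonpos_of_le_mul_integral hnc (C := μ * (1 / m * (b - a) * ((b - a) * (b - a))))
      (by positivity) (fun y hy => ?_) hx
    have hFy := hF0 y hy.1
    refine max_le ?_ (mul_nonneg (by positivity) hFy)
    have h1 := mul_le_mul_of_nonneg_left (hDDlow y hy) hμ
    have h2 := mul_nonneg hβ (sub_nonneg.2 hy.1)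
    simp only [hM]
    simp only [hF] at h1
    linarith
  have hwnn : 0 ≤ᵐ[volume.restrict (Ioo a b)] w := by
    filter_upwards [hκ, h, ae_restrict_mem measurableSet_Ioo] with x hk hx hxm
    have h1 := hnz x (Ioo_subset_Icc_self hxm)
    have h2 : -M x ≤ n x := le_max_left _ _
    have h3 : 0 ≤ κ x * w x := by rw [hx]; linarith
    exact nonneg_of_mul_nonneg_right h3 (hm.trans_le hk)
  -- A nonnegative `w` with zero mean vanishes.
  exact (integral_eq_zero_iff_of_nonneg_ae hwnn hw).1 h0

end Positivity

/-! ### Structure of `H02` and compactness of its inclusion -/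

section Sobolev

variable {a b : ℝ}

theorem IsTestFunction.mk_mem_H02 {φ : ℝ → ℝ} (hφ : IsTestFunction a b φ) :
    ((hφ.memLp.toLp : L2 a b), (hφ.deriv.deriv.memLp.toLp : L2 a b)) ∈ H02 a b :=
  Submodule.le_topologicalClosure _ ⟨φ, hφ, MemLp.coeFn_toLp hφ.memLp, by
    rw [IsTestFunction.iteratedDeriv_two]; exact MemLp.coeFn_toLp hφ.deriv.deriv.memLp⟩

/-- Both conditions are closed in `L² × L²` and hold for test functions, so they pass to the
closure. They encode `u(a) = u'(a) = 0` and `u'(b) = 0`; the condition `u(b) = 0` is not needed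
later. -/
theorem H02_subset (hab : a ≤ b) {p : L2 a b × L2 a b} (hp : p ∈ H02 a b) :
    p.1 = doublePrimitiveL2 a b p.2 ∧ ∫ x in Ioo a b, p.2 x = 0 := by
  have hint : ∀ w : L2 a b, inner ℝ (Lp.const 2 (volume.restrict (Ioo a b)) (1 : ℝ)) w
      = ∫ x in Ioo a b, w x := by
    intro w
    rw [L2.inner_def]
    refine integral_congr_ae ?_
    filter_upwards [Lp.coeFn_const (p := 2) (μ := volume.restrict (Ioo a b)) (1 : ℝ)] with t h1
    rw [h1]; simp
  have hclosed : IsClosed {p : L2 a b × L2 a b | p.1 = doublePrimitiveL2 a b p.2 ∧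
      inner ℝ (Lp.const 2 (volume.restrict (Ioo a b)) (1 : ℝ)) p.2 = 0} :=
    (isClosed_eq (by fun_prop) (by fun_prop)).inter (isClosed_eq (by fun_prop) (by fun_prop))
  have hsub := closure_minimal (s := (testGraph a b : Set (L2 a b × L2 a b))) ?_ hclosed
  · have := hsub hp
    rwa [mem_ofPred_eq, hint] at this
  · rintro q ⟨φ, hφ, h1, h2⟩
    rw [IsTestFunction.iteratedDeriv_two] at h2
    refine ⟨Lp.ext ?_, ?_⟩
    · filter_upwards [h1, coeFn_doublePrimitiveL2 q.2, ae_restrict_mem measurableSet_Ioo]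
        with x hx1 hx2 hx
      rw [hx1, hx2, doublePrimitive_congr h2,
        hφ.doublePrimitive_deriv_deriv (Ioo_subset_Icc_self hx)]
    · rw [hint, integral_congr_ae h2, hφ.deriv.integral_deriv hab]

instance : CompleteSpace (H02 a b) :=
  (Submodule.isClosed_topologicalClosure (testGraph a b)).completeSpace_coe

/-- The inclusion of `H₀²(a, b)` into `L²(a, b)`. -/
noncomputable def inclusionL2 (a b : ℝ) : H02 a b →L[ℝ] L2 a b :=
  (ContinuousLinearMap.fst ℝ (L2 a b) (L2 a b)).comp (H02 a b).subtypeL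

/-- The second derivative as an operator on `H₀²(a, b)`. -/
noncomputable def secondDeriv (a b : ℝ) : H02 a b →L[ℝ] L2 a b :=
  (ContinuousLinearMap.snd ℝ (L2 a b) (L2 a b)).comp (H02 a b).subtypeL

theorem inclusionL2_eq (hab : a ≤ b) (u : H02 a b) :
    inclusionL2 a b u = doublePrimitiveL2 a b (secondDeriv a b u) :=
  (H02_subset hab u.2).1

theorem isCompactOperator_inclusionL2 (hab : a ≤ b) : IsCompactOperator (inclusionL2 a b) := by
  have : (inclusionL2 a b : H02 a b → L2 a b) = doublePrimitiveL2 a b ∘ secondDeriv a b :=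
    funext fun u => inclusionL2_eq hab u
  rw [this]
  exact (isCompactOperator_doublePrimitiveL2 hab).comp_clm (secondDeriv a b)

/-- The Poincaré-type inequality behind coercivity. -/
theorem norm_le_mul_norm_secondDeriv (hab : a ≤ b) (u : H02 a b) :
    ‖u‖ ≤ (‖doublePrimitiveL2 a b‖ + 1) * ‖secondDeriv a b u‖ := by
  have h1 : ‖inclusionL2 a b u‖ ≤ ‖doublePrimitiveL2 a b‖ * ‖secondDeriv a b u‖ := by
    rw [inclusionL2_eq hab]; exact ContinuousLinearMap.le_opNorm _ _
  have h2 : ‖u‖ = max ‖inclusionL2 a b u‖ ‖secondDeriv a b u‖ := rfl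
  have h3 := norm_nonneg (secondDeriv a b u)
  have h4 := mul_nonneg (norm_nonneg (doublePrimitiveL2 a b)) h3
  rw [h2]
  exact max_le (by linarith) (by linarith)

end Sobolev

/-! ### The forms of the rod, the bending moment and simplicity -/

/-- A smooth stiffness on `s` lying between two positive constants. -/
structure IsStiffness (s : Set ℝ) (k : ℝ → ℝ) : Prop where
  cont : ContinuousOn k s
  bdd : ∃ m M : ℝ, 0 < m ∧ ∀ x ∈ s, m ≤ k x ∧ k x ≤ M

theorem IsStiffness.pos {s : Set ℝ} {k : ℝ → ℝ} (h : IsStiffness s k) {x : ℝ} (hx : x ∈ s) :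
    0 < k x := by
  obtain ⟨m, M, hm, hk⟩ := h.bdd
  exact hm.trans_le (hk x hx).1

section Forms

variable {a b : ℝ} {k₀ k₁ : ℝ → ℝ}

theorem IsStiffness.exists_form {s : Set ℝ} {k : ℝ → ℝ} (h : IsStiffness s k)
    (hs : MeasurableSet s) (hsub : s ⊆ Ioo a b) :
    ∃ D : L2 a b →L[ℝ] L2 a b →L[ℝ] ℝ, ∀ v w, D v w = ∫ x in s, k x * v x * w x := by
  obtain ⟨m, M, hm, hk⟩ := h.bdd
  exact exists_weighted_form hs hsub h.cont (M := M) fun x hx => by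
    rw [abs_of_pos (h.pos hx)]; exact (hk x hx).2

theorem formEps_symm (ε : ℝ) (p q : L2 a b × L2 a b) :
    formEps k₀ k₁ ε p q = formEps k₀ k₁ ε q p := by
  have h0 : form0 k₀ p q = form0 k₀ q p :=
    integral_congr_ae (Eventually.of_forall fun x => by simp only; ring)
  have h1 : form1 k₁ p q = form1 k₁ q p :=
    integral_congr_ae (Eventually.of_forall fun x => by simp only; ring)
  rw [formEps, formEps, h0, h1]

theorem form0_self_nonneg (h : IsStiffness (Ioo a 0) k₀) (p : L2 a b × L2 a b) :
    0 ≤ form0 k₀ p p :=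
  setIntegral_nonneg measurableSet_Ioo fun x hx => by
    rw [mul_assoc]; exact mul_nonneg (h.pos hx).le (mul_self_nonneg _)

theorem form1_self_nonneg (h : IsStiffness (Ioo 0 b) k₁) (p : L2 a b × L2 a b) :
    0 ≤ form1 k₁ p p :=
  setIntegral_nonneg measurableSet_Ioo fun x hx => by
    rw [mul_assoc]; exact mul_nonneg (h.pos hx).le (mul_self_nonneg _)

/-- Changing `δ` to `ε` rescales only the nonnegative `a₁` term, by `(ε / δ) ^ 4`; the `1` in the
maximum covers `a₀`. -/
theorem formEps_le_mul (h₀ : IsStiffness (Ioo a 0) k₀) (h₁ : IsStiffness (Ioo 0 b) k₁) {ε δ : ℝ}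
    (hδ : 0 < δ) (p : L2 a b × L2 a b) :
    formEps k₀ k₁ ε p p ≤ max 1 ((ε / δ) ^ 4) * formEps k₀ k₁ δ p p := by
  have e0 := form0_self_nonneg h₀ p
  have e1 := form1_self_nonneg h₁ p
  have m1 := mul_le_mul_of_nonneg_right (le_max_left 1 ((ε / δ) ^ 4)) e0
  have m2 := mul_le_mul_of_nonneg_right (le_max_right 1 ((ε / δ) ^ 4))
    (by positivity : 0 ≤ δ ^ 4 * form1 k₁ p p)
  have e : (ε / δ) ^ 4 * (δ ^ 4 * form1 k₁ p p) = ε ^ 4 * form1 k₁ p p := by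
    field_simp
  simp only [formEps]
  rw [mul_add]
  linarith

theorem formEps_coercive (ha : a < 0) (hb : 0 < b) (h₀ : IsStiffness (Ioo a 0) k₀)
    (h₁ : IsStiffness (Ioo 0 b) k₁) {ε : ℝ} (hε : 0 < ε) :
    ∃ c : ℝ, 0 < c ∧ ∀ u : H02 a b, c * ‖u‖ ^ 2 ≤ formEps k₀ k₁ ε (u : L2 a b × L2 a b) u := by
  obtain ⟨m₀, M₀, hm₀, hk₀⟩ := h₀.bdd
  obtain ⟨m₁, M₁, hm₁, hk₁⟩ := h₁.bdd
  set A := ‖doublePrimitiveL2 a b‖ + 1 with hA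
  have hApos : 0 < A := by positivity
  set d := min m₀ (ε ^ 4 * m₁) with hd
  have hdpos : 0 < d := lt_min hm₀ (by positivity)
  refine ⟨d / A ^ 2, by positivity, fun u => ?_⟩
  set w := (u : L2 a b × L2 a b).2 with hw
  have h1 : ‖u‖ ≤ A * ‖w‖ := norm_le_mul_norm_secondDeriv (ha.trans hb).le u
  have h2 : ‖u‖ ^ 2 ≤ A ^ 2 * ‖w‖ ^ 2 := by
    rw [← mul_pow]; exact pow_le_pow_left₀ (norm_nonneg _) h1 2
  have h3 : ‖w‖ ^ 2 = (∫ x in Ioo a 0, w x * w x) + ∫ x in Ioo 0 b, w x * w x := by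
    rw [norm_sq_eq_integral, integral_Ioo_add_adjacent ha.le hb.le (integrableOn_sq w)]
  have h4 : m₀ * ∫ x in Ioo a 0, w x * w x ≤ form0 k₀ (u : L2 a b × L2 a b) u :=
    mul_integral_sq_le_weighted measurableSet_Ioo (Ioo_subset_Ioo_right hb.le) h₀.cont hm₀ hk₀ w
  have h5 : m₁ * ∫ x in Ioo 0 b, w x * w x ≤ form1 k₁ (u : L2 a b × L2 a b) u :=
    mul_integral_sq_le_weighted measurableSet_Ioo (Ioo_subset_Ioo_left ha.le) h₁.cont hm₁ hk₁ w
  have n0 : 0 ≤ ∫ x in Ioo a 0, w x * w x := integral_nonneg fun x => mul_self_nonneg _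
  have n1 : 0 ≤ ∫ x in Ioo 0 b, w x * w x := integral_nonneg fun x => mul_self_nonneg _
  have h6 := mul_le_mul_of_nonneg_right (min_le_left m₀ (ε ^ 4 * m₁)) n0
  have h7 := mul_le_mul_of_nonneg_right (min_le_right m₀ (ε ^ 4 * m₁)) n1
  have h8 := mul_le_mul_of_nonneg_left h5 (by positivity : 0 ≤ ε ^ 4)
  have h9 : d / A ^ 2 * ‖u‖ ^ 2 ≤ d * ‖w‖ ^ 2 := by
    rw [div_mul_eq_mul_div, div_le_iff₀ (by positivity)]
    have := mul_le_mul_of_nonneg_left h2 hdpos.le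
    linarith
  refine h9.trans ?_
  rw [formEps, h3, mul_add]
  linarith

theorem exists_formEps (hb : 0 < b) (ha : a < 0) (h₀ : IsStiffness (Ioo a 0) k₀)
    (h₁ : IsStiffness (Ioo 0 b) k₁) (ε : ℝ) :
    ∃ B : H02 a b →L[ℝ] H02 a b →L[ℝ] ℝ,
      ∀ u v, B u v = formEps k₀ k₁ ε (u : L2 a b × L2 a b) v := by
  obtain ⟨D₀, hD₀⟩ := h₀.exists_form (a := a) (b := b) measurableSet_Ioo
    (Ioo_subset_Ioo_right hb.le)
  obtain ⟨D₁, hD₁⟩ := h₁.exists_form (a := a) (b := b) measurableSet_Ioo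
    (Ioo_subset_Ioo_left ha.le)
  refine ⟨(D₀ + ε ^ 4 • D₁).bilinearComp (secondDeriv a b) (secondDeriv a b), fun u v => ?_⟩
  rw [ContinuousLinearMap.bilinearComp_apply]
  simp only [add_apply, smul_apply, smul_eq_mul, hD₀, hD₁]
  rfl

theorem isEigenvalue_iff {B : H02 a b →L[ℝ] H02 a b →L[ℝ] ℝ} {ε : ℝ}
    (hB : ∀ u v, B u v = formEps k₀ k₁ ε (u : L2 a b × L2 a b) v) (μ : ℝ) :
    IsEigenvalue a b k₀ k₁ ε μ ↔ ∃ u, IsFormEigenvector B (inclusionL2 a b) μ u := by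
  constructor
  · rintro ⟨u, hu, h0, h⟩
    exact ⟨⟨u, hu⟩, h0, fun φ => by rw [hB]; exact sub_eq_zero.1 (h φ φ.2)⟩
  · rintro ⟨u, h0, h⟩
    refine ⟨u, u.2, h0, fun φ hφ => ?_⟩
    have := h ⟨φ, hφ⟩
    rw [hB] at this
    exact sub_eq_zero.2 this

/-- The stiffness of the whole rod. -/
noncomputable def stiffness (a b : ℝ) (k₀ k₁ : ℝ → ℝ) (ε : ℝ) (x : ℝ) : ℝ :=
  (Ioo a 0).indicator k₀ x + ε ^ 4 * (Ioo 0 b).indicator k₁ x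

theorem stiffness_of_mem_left {ε x : ℝ} (hx : x ∈ Ioo a 0) : stiffness a b k₀ k₁ ε x = k₀ x := by
  have : x ∉ Ioo 0 b := fun h => lt_asymm h.1 hx.2
  simp [stiffness, indicator_of_mem hx, indicator_of_notMem this]

theorem stiffness_of_mem_right {ε x : ℝ} (hx : x ∈ Ioo 0 b) :
    stiffness a b k₀ k₁ ε x = ε ^ 4 * k₁ x := by
  have : x ∉ Ioo a 0 := fun h => lt_asymm h.2 hx.1
  simp [stiffness, indicator_of_mem hx, indicator_of_notMem this]

theorem ae_mem_left_or_right :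
    ∀ᵐ x ∂volume.restrict (Ioo a b), x ∈ Ioo a 0 ∨ x ∈ Ioo 0 b := by
  have h0 : ∀ᵐ x ∂volume.restrict (Ioo a b), x ≠ 0 := by
    refine ae_restrict_of_ae ?_
    simp [ae_iff, measure_singleton]
  filter_upwards [ae_restrict_mem measurableSet_Ioo, h0] with x hx hx0
  rcases lt_or_gt_of_ne hx0 with h | h
  · exact Or.inl ⟨hx.1, h⟩
  · exact Or.inr ⟨h, hx.2⟩

theorem exists_le_stiffness (h₀ : IsStiffness (Ioo a 0) k₀) (h₁ : IsStiffness (Ioo 0 b) k₁)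
    {ε : ℝ} (hε : 0 < ε) :
    ∃ m : ℝ, 0 < m ∧ ∀ᵐ x ∂volume.restrict (Ioo a b), m ≤ stiffness a b k₀ k₁ ε x := by
  obtain ⟨m₀, M₀, hm₀, hk₀⟩ := h₀.bdd
  obtain ⟨m₁, M₁, hm₁, hk₁⟩ := h₁.bdd
  refine ⟨min m₀ (ε ^ 4 * m₁), lt_min hm₀ (by positivity), ?_⟩
  filter_upwards [ae_mem_left_or_right] with x hx
  rcases hx with hx | hx
  · rw [stiffness_of_mem_left hx]; exact (min_le_left _ _).trans (hk₀ x hx).1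
  · rw [stiffness_of_mem_right hx]
    exact (min_le_right _ _).trans (mul_le_mul_of_nonneg_left (hk₁ x hx).1 (by positivity))

theorem integrableOn_stiffness_mul (h₀ : IsStiffness (Ioo a 0) k₀)
    (h₁ : IsStiffness (Ioo 0 b) k₁) (ε : ℝ) {f : ℝ → ℝ} (hf : IntegrableOn f (Ioo a b)) :
    IntegrableOn (fun x => stiffness a b k₀ k₁ ε x * f x) (Ioo a b) := by
  obtain ⟨m₀, M₀, hm₀, hk₀⟩ := h₀.bdd
  obtain ⟨m₁, M₁, hm₁, hk₁⟩ := h₁.bdd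
  refine Integrable.bdd_mul (c := |M₀| + ε ^ 4 * |M₁|) hf ?_ ?_
  · exact (aestronglyMeasurable_indicator_of_continuousOn measurableSet_Ioo h₀.cont _).add
      ((aestronglyMeasurable_indicator_of_continuousOn measurableSet_Ioo h₁.cont _).const_mul _)
  · filter_upwards [ae_mem_left_or_right] with x hx
    have e0 : 0 ≤ |M₀| := abs_nonneg _
    have e1 : 0 ≤ ε ^ 4 * |M₁| := by positivity
    rcases hx with hx | hx
    · rw [stiffness_of_mem_left hx, Real.norm_eq_abs, abs_of_pos (h₀.pos hx)]
      linarith [(hk₀ x hx).2, le_abs_self M₀]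
    · rw [stiffness_of_mem_right hx, Real.norm_eq_abs, abs_mul, abs_of_pos (h₁.pos hx),
        abs_of_nonneg (by positivity : 0 ≤ ε ^ 4)]
      have := mul_le_mul_of_nonneg_left ((hk₁ x hx).2.trans (le_abs_self M₁))
        (by positivity : 0 ≤ ε ^ 4)
      linarith

theorem formEps_eq_integral_stiffness (ha : a ≤ 0) (hb : 0 ≤ b) (h₀ : IsStiffness (Ioo a 0) k₀)
    (h₁ : IsStiffness (Ioo 0 b) k₁) (ε : ℝ) (p q : L2 a b × L2 a b) :
    formEps k₀ k₁ ε p q = ∫ x in Ioo a b, stiffness a b k₀ k₁ ε x * (p.2 x * q.2 x) := by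
  have hpq : IntegrableOn (fun x => p.2 x * q.2 x) (Ioo a b) :=
    (L2.integrable_inner (𝕜 := ℝ) p.2 q.2).congr (Eventually.of_forall fun x => by simp [mul_comm])
  rw [integral_Ioo_add_adjacent ha hb (integrableOn_stiffness_mul h₀ h₁ ε hpq), formEps, form0,
    form1, ← integral_const_mul]
  congr 1
  · refine setIntegral_congr_fun measurableSet_Ioo fun x hx => ?_
    rw [stiffness_of_mem_left hx]; ring
  · refine setIntegral_congr_fun measurableSet_Ioo fun x hx => ?_
    rw [stiffness_of_mem_right hx]; ring

/-- The bending moment `κ u''` of a weak solution of `(κ u'')'' = μ u`. -/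
theorem exists_moment_eq (ha : a < 0) (hb : 0 < b) (h₀ : IsStiffness (Ioo a 0) k₀)
    (h₁ : IsStiffness (Ioo 0 b) k₁) {ε μ : ℝ} {p : L2 a b × L2 a b}
    (h : ∀ φ ∈ H02 a b, formEps k₀ k₁ ε p φ = μ * inner ℝ p.1 φ.1) :
    ∃ α β : ℝ, ∀ᵐ x ∂volume.restrict (Ioo a b), stiffness a b k₀ k₁ ε x * p.2 x =
      α + β * (x - a) + μ * doublePrimitive a b p.1 x := by
  have hp1 := integrableOn_L2 p.1
  have hK := integrableOn_stiffness_mul h₀ h₁ ε (integrableOn_L2 p.2)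
  have hD : IntegrableOn (doublePrimitive a b p.1) (Ioo a b) :=
    (continuous_doublePrimitive hp1).integrableOn_Icc.mono_set Ioo_subset_Icc_self
  obtain ⟨α, β, hαβ⟩ := IsTestFunction.ae_eq_affine_of_integral_mul_deriv_deriv_eq_zero
    (ha.trans hb) (hK.sub (hD.const_mul μ)) fun φ hφ => by
      have h2 := h _ hφ.mk_mem_H02
      rw [formEps_eq_integral_stiffness ha.le hb.le h₀ h₁, L2.inner_def] at h2
      have e1 : ∫ x in Ioo a b, stiffness a b k₀ k₁ ε x *
          (p.2 x * (hφ.deriv.deriv.memLp.toLp : L2 a b) x)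
          = ∫ x in Ioo a b, stiffness a b k₀ k₁ ε x * p.2 x * deriv (deriv φ) x := by
        refine integral_congr_ae ?_
        filter_upwards [MemLp.coeFn_toLp (hφ.deriv.deriv.memLp)] with x hx
        rw [hx]; ring
      have e2 : ∫ x in Ioo a b, inner ℝ (p.1 x) ((hφ.memLp.toLp : L2 a b) x)
          = ∫ x in Ioo a b, p.1 x * φ x := by
        refine integral_congr_ae ?_
        filter_upwards [MemLp.coeFn_toLp hφ.memLp] with x hx
        rw [hx]; simp [mul_comm]
      rw [e1, e2, ← hφ.integral_doublePrimitive_mul_deriv_deriv hp1, ← integral_const_mul] at h2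
      have hd := hφ.deriv.deriv
      rw [← sub_eq_zero, ← integral_sub (hd.integrableOn_mul hK)
        ((hd.integrableOn_mul hD).const_mul μ)] at h2
      rw [← h2]
      refine integral_congr_ae (Eventually.of_forall fun x => ?_)
      simp only [Pi.sub_apply]; ring
  refine ⟨α + β * a, β, ?_⟩
  filter_upwards [hαβ] with x hx
  simp only [Pi.sub_apply] at hx
  linarith

theorem fst_eq_zero_of_moment_eq (hab : a ≤ b) {p : L2 a b × L2 a b} (hp : p ∈ H02 a b)
    {κ : ℝ → ℝ} {m β μ : ℝ} (hm : 0 < m) (hμ : 0 ≤ μ)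
    (hκ : ∀ᵐ x ∂volume.restrict (Ioo a b), m ≤ κ x)
    (h : ∀ᵐ x ∂volume.restrict (Ioo a b), κ x * p.2 x =
      β * (x - a) + μ * doublePrimitive a b p.1 x) : p.1 = 0 := by
  -- Replacing `p` by `-p` flips the sign of `β`.
  wlog hβ : 0 ≤ β generalizing p β
  · have hneg := this (p := -p) (β := -β) ((H02 a b).neg_mem hp) (by
      filter_upwards [h, Lp.coeFn_neg p.2] with x hx h2
      have e1 : doublePrimitive a b ((-p).1 : L2 a b) x = -doublePrimitive a b p.1 x := by
        rw [← neg_one_mul, ← doublePrimitive_smul]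
        refine congrFun (doublePrimitive_congr ?_) x
        filter_upwards [Lp.coeFn_neg p.1] with y hy
        rw [Prod.fst_neg, hy]; simp
      rw [e1, Prod.snd_neg, h2, Pi.neg_apply]
      linarith) (by linarith)
    simpa using hneg
  obtain ⟨h1, h2⟩ := H02_subset hab hp
  have h3 : (p.1 : ℝ → ℝ) =ᵐ[volume.restrict (Ioo a b)] doublePrimitive a b p.2 := by
    rw [h1]; exact coeFn_doublePrimitiveL2 _
  have hw := ae_eq_zero_of_mul_eq_linear_add hm hμ hβ hκ (integrableOn_L2 p.2) h2 (by
    rw [← doublePrimitive_congr h3]; exact h)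
  have : p.2 = 0 := (Lp.eq_zero_iff_ae_eq_zero).2 hw
  rw [h1, this, map_zero]

/-- The constant `α` is the moment at the left end. It is nonzero for an eigenvector, so a suitable
multiple of `u` cancels that of `v`; the difference has zero moment at `a` and therefore vanishes.
-/
theorem simpleSpectrum (ha : a < 0) (hb : 0 < b) (h₀ : IsStiffness (Ioo a 0) k₀)
    (h₁ : IsStiffness (Ioo 0 b) k₁) {ε : ℝ} (hε : 0 < ε)
    {B : H02 a b →L[ℝ] H02 a b →L[ℝ] ℝ}
    (hB : ∀ u v, B u v = formEps k₀ k₁ ε (u : L2 a b × L2 a b) v) :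
    SimpleSpectrum B (inclusionL2 a b) := by
  intro μ u v hu hv
  have hab := (ha.trans hb).le
  have hμ : 0 ≤ μ := by
    obtain ⟨c, hc, hcoer⟩ := formEps_coercive ha hb h₀ h₁ hε
    exact (hu.pos hc fun u => by rw [hB]; exact hcoer u).le
  obtain ⟨m, hm, hκ⟩ := exists_le_stiffness h₀ h₁ hε
  have hweak : ∀ w, IsFormEigenvector B (inclusionL2 a b) μ w → ∀ φ ∈ H02 a b,
      formEps k₀ k₁ ε (w : L2 a b × L2 a b) φ = μ * inner ℝ (w : L2 a b × L2 a b).1 φ.1 :=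
    fun w hw φ hφ => by have := hw.2 ⟨φ, hφ⟩; rwa [hB] at this
  obtain ⟨α, β, hαβ⟩ := exists_moment_eq ha hb h₀ h₁ (hweak u hu)
  obtain ⟨α', β', hαβ'⟩ := exists_moment_eq ha hb h₀ h₁ (hweak v hv)
  have hα : α ≠ 0 := by
    rintro rfl
    refine hu.1 (fst_eq_zero_of_moment_eq hab u.2 hm hμ hκ (β := β) ?_)
    simpa using hαβ
  set t := α' / α with ht
  have hz := fst_eq_zero_of_moment_eq hab (v - t • u).2 hm hμ hκ (β := β' - t * β) (by
    have e2 : (((v - t • u : H02 a b) : L2 a b × L2 a b).2 : ℝ → ℝ) =ᵐ[volume.restrict (Ioo a b)]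
        (v : L2 a b × L2 a b).2 - t • ((u : L2 a b × L2 a b).2 : ℝ → ℝ) :=
      (Lp.coeFn_sub _ _).trans ((EventuallyEq.refl _ _).sub (Lp.coeFn_smul _ _))
    have e1 : (((v - t • u : H02 a b) : L2 a b × L2 a b).1 : ℝ → ℝ) =ᵐ[volume.restrict (Ioo a b)]
        (v : L2 a b × L2 a b).1 + (-t) • ((u : L2 a b × L2 a b).1 : ℝ → ℝ) := by
      refine ((Lp.coeFn_sub _ _).trans ((EventuallyEq.refl _ _).sub (Lp.coeFn_smul _ _))).trans ?_
      rw [neg_smul, ← sub_eq_add_neg]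
    filter_upwards [hαβ, hαβ', e2] with x h1 h2 h3
    rw [h3, doublePrimitive_congr e1, doublePrimitive_add (integrableOn_L2 _)
      ((integrableOn_L2 _).smul (-t)), doublePrimitive_smul]
    simp only [Pi.sub_apply, Pi.smul_apply, smul_eq_mul]
    have : t * α = α' := by rw [ht]; field_simp
    linear_combination h2 - t * h1 - this)
  refine ⟨t, ?_⟩
  have : inclusionL2 a b (v - t • u) = 0 := hz
  rw [map_sub, map_smul] at this
  exact sub_eq_zero.1 this

end Forms

/-! ### Trial functions supported in the soft part `(0, b)` -/

section TrialSpaces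

variable {a b : ℝ} {k₀ k₁ : ℝ → ℝ}

theorem IsTestFunction.mono {c d : ℝ} {φ : ℝ → ℝ} (hφ : IsTestFunction c d φ)
    (h : Ioo c d ⊆ Ioo a b) : IsTestFunction a b φ :=
  ⟨hφ.smooth, hφ.compact, hφ.support.trans h⟩

/-- Nonzero test functions on `(0, b)` with pairwise disjoint supports. -/
theorem exists_disjoint_testFunctions (hb : 0 < b) (n : ℕ) :
    ∃ φ : Fin n → ℝ → ℝ, (∀ i, IsTestFunction 0 b (φ i)) ∧ (∀ i, 0 < ∫ x in Ioo 0 b, φ i x) ∧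
      ∀ i j, i ≠ j → ∀ x, φ i x * φ j x = 0 := by
  set h : ℝ := b / n with hh
  rcases Nat.eq_zero_or_pos n with rfl | hn
  · exact ⟨Fin.elim0, fun i => i.elim0, fun i => i.elim0, fun i => i.elim0⟩
  have hnR : (0 : ℝ) < n := Nat.cast_pos.2 hn
  have hpos : 0 < h := div_pos hb hnR
  have hex : ∀ i : Fin n, ∃ η, IsTestFunction (i * h) ((i + 1) * h) η ∧
      ∫ x in Ioo ((i : ℝ) * h) ((i + 1) * h), η x = 1 := fun i =>
    IsTestFunction.exists_integral_eq_one (by linarith)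
  choose φ hφ h1 using hex
  have hsub : ∀ i : Fin n, Ioo ((i : ℝ) * h) ((i + 1) * h) ⊆ Ioo 0 b := fun i =>
    Ioo_subset_Ioo (by positivity) (by
      have : ((i : ℕ) : ℝ) + 1 ≤ n := by exact_mod_cast i.2
      calc ((i : ℝ) + 1) * h ≤ n * h := mul_le_mul_of_nonneg_right this hpos.le
        _ = b := by rw [hh]; field_simp)
  refine ⟨φ, fun i => (hφ i).mono (hsub i), fun i => ?_, ?_⟩
  · rw [setIntegral_eq_of_subset_of_forall_sdiff_eq_zero measurableSet_Ioo (hsub i)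
      fun x hx => (hφ i).eq_zero hx.2, h1]
    exact one_pos
  · have key : ∀ i j : Fin n, i < j → ∀ x, φ i x * φ j x = 0 := by
      intro i j hij x
      by_cases hx : x ∈ Ioo ((i : ℝ) * h) ((i + 1) * h)
      · have : ((i : ℕ) : ℝ) + 1 ≤ (j : ℕ) := by exact_mod_cast hij
        rw [(hφ j).eq_zero fun hx' => ?_, mul_zero]
        have := mul_le_mul_of_nonneg_right this hpos.le
        linarith [hx.2, hx'.1]
      · rw [(hφ i).eq_zero hx, zero_mul]
    intro i j hij x
    rcases lt_or_gt_of_ne hij with h | h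
    · exact key i j h x
    · rw [mul_comm]; exact key j i h x

/-- The form `a₀` vanishes on subspaces of arbitrary finite dimension. -/
theorem exists_submodule_form0_eq_zero (ha : a < 0) (hb : 0 < b)
    (h₀ : IsStiffness (Ioo a 0) k₀) (n : ℕ) :
    ∃ S : Submodule ℝ (H02 a b), FiniteDimensional ℝ S ∧ Module.finrank ℝ S = n ∧
      (∀ u ∈ S, inclusionL2 a b u = 0 → u = 0) ∧
      ∀ u ∈ S, form0 k₀ (u : L2 a b × L2 a b) u = 0 := by
  obtain ⟨φ, hφ, hpos, hdisj⟩ := exists_disjoint_testFunctions hb n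
  have hφ' : ∀ i, IsTestFunction a b (φ i) := fun i => (hφ i).mono (Ioo_subset_Ioo_left ha.le)
  set p : Fin n → H02 a b := fun i => ⟨_, (hφ' i).mk_mem_H02⟩ with hp
  have hp1 : ∀ i, inclusionL2 a b (p i) = (hφ' i).memLp.toLp := fun i => rfl
  have hp2 : ∀ i, secondDeriv a b (p i) = (hφ' i).deriv.deriv.memLp.toLp := fun i => rfl
  have hli : LinearIndependent ℝ fun i => inclusionL2 a b (p i) := by
    refine linearIndependent_of_ne_zero_of_inner_eq_zero (𝕜 := ℝ) (fun i h => ?_) fun i j hij => ?_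
    · have h2 : (inclusionL2 a b (p i) : ℝ → ℝ) =ᵐ[volume.restrict (Ioo a b)] 0 :=
        Lp.eq_zero_iff_ae_eq_zero.1 h
      rw [hp1] at h2
      have h3 := (MemLp.coeFn_toLp (hφ' i).memLp).symm.trans h2
      have h4 : φ i =ᵐ[volume.restrict (Ioo 0 b)] 0 :=
        ae_restrict_of_ae_restrict_of_subset (Ioo_subset_Ioo_left ha.le) h3
      have h5 := hpos i
      rw [integral_congr_ae h4] at h5
      simp at h5
    · change inner ℝ (inclusionL2 a b (p i)) (inclusionL2 a b (p j)) = 0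
      rw [hp1, hp1, L2.inner_def]
      refine (integral_congr_ae (g := fun _ => 0) ?_).trans (by simp)
      filter_upwards [MemLp.coeFn_toLp (hφ' i).memLp, MemLp.coeFn_toLp (hφ' j).memLp] with x hi hj
      rw [hi, hj]
      simpa [mul_comm] using hdisj i j hij x
  have hlip : LinearIndependent ℝ p :=
    LinearIndependent.of_comp (inclusionL2 a b : H02 a b →ₗ[ℝ] L2 a b) hli
  refine ⟨Submodule.span ℝ (range p), FiniteDimensional.span_of_finite ℝ (finite_range p), ?_,
    ?_, ?_⟩
  · simpa using finrank_span_eq_card hlip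
  · intro u hu h
    obtain ⟨c, rfl⟩ := (Submodule.mem_span_range_iff_exists_fun ℝ).1 hu
    rw [map_sum] at h
    simp only [map_smul] at h
    have hc := Fintype.linearIndependent_iff.1 hli c h
    exact Finset.sum_eq_zero fun i _ => by rw [hc i, zero_smul]
  · obtain ⟨D, hD⟩ := h₀.exists_form (a := a) (b := b) measurableSet_Ioo
      (Ioo_subset_Ioo_right hb.le)
    -- Vanishing of the quadratic form alone would not pass to linear combinations; membership in
    -- the kernel of `u ↦ a₀(u, ·)` does.
    have hle : Submodule.span ℝ (range p) ≤
        LinearMap.ker (D.comp (secondDeriv a b) : H02 a b →ₗ[ℝ] L2 a b →L[ℝ] ℝ) := by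
      rw [Submodule.span_le]
      rintro _ ⟨i, rfl⟩
      rw [SetLike.mem_coe, LinearMap.mem_ker]
      ext w
      change D (secondDeriv a b (p i)) w = 0
      rw [hD, hp2]
      refine (integral_congr_ae (g := fun _ => 0) ?_).trans (by simp)
      have h3 := ae_restrict_of_ae_restrict_of_subset (Ioo_subset_Ioo_right hb.le)
        (MemLp.coeFn_toLp (hφ' i).deriv.deriv.memLp)
      filter_upwards [h3, ae_restrict_mem measurableSet_Ioo] with x hx hxm
      rw [hx, (hφ i).deriv.deriv.eq_zero fun h => lt_asymm h.1 hxm.2]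
      simp
    intro u hu
    have h1 := LinearMap.mem_ker.1 (hle hu)
    have h2 : D (secondDeriv a b u) (secondDeriv a b u) = 0 :=
      congrArg (fun f : L2 a b →L[ℝ] ℝ => f (secondDeriv a b u)) h1
    rw [hD] at h2
    exact h2

theorem exists_submodule_formEps_le (ha : a < 0) (hb : 0 < b) (h₀ : IsStiffness (Ioo a 0) k₀)
    (h₁ : IsStiffness (Ioo 0 b) k₁) (n : ℕ) :
    ∃ S : Submodule ℝ (H02 a b), FiniteDimensional ℝ S ∧ Module.finrank ℝ S = n ∧
      (∀ u ∈ S, inclusionL2 a b u = 0 → u = 0) ∧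
      ∃ C : ℝ, ∀ ε : ℝ, ∀ u ∈ S,
        formEps k₀ k₁ ε (u : L2 a b × L2 a b) u ≤ C * ε ^ 4 * ‖inclusionL2 a b u‖ ^ 2 := by
  obtain ⟨S, hfd, hdim, hinj, h0⟩ := exists_submodule_form0_eq_zero (b := b) ha hb h₀ n
  obtain ⟨D, hD⟩ := h₁.exists_form (a := a) (b := b) measurableSet_Ioo
    (Ioo_subset_Ioo_left ha.le)
  obtain ⟨C, -, hC⟩ := exists_form_le_mul_norm_sq S hinj
    (D.bilinearComp (secondDeriv a b) (secondDeriv a b))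
  refine ⟨S, hfd, hdim, hinj, C, fun ε u hu => ?_⟩
  have h1 : form1 k₁ (u : L2 a b × L2 a b) u ≤ C * ‖inclusionL2 a b u‖ ^ 2 := by
    have := hC u hu
    rw [ContinuousLinearMap.bilinearComp_apply, hD] at this
    exact this
  have h2 := mul_le_mul_of_nonneg_left h1 (by positivity : 0 ≤ ε ^ 4)
  rw [formEps, h0 u hu]
  linarith

end TrialSpaces

/-! ### Eigenvalue bounds and dependence on `ε` -/

section Eigenvalues

variable {a b : ℝ} {k₀ k₁ : ℝ → ℝ} {ε : ℝ}

theorem isEigenvalue_pos (ha : a < 0) (hb : 0 < b) (h₀ : IsStiffness (Ioo a 0) k₀)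
    (h₁ : IsStiffness (Ioo 0 b) k₁) (hε : 0 < ε) {μ : ℝ} (hμ : IsEigenvalue a b k₀ k₁ ε μ) :
    0 < μ := by
  obtain ⟨B, hB⟩ := exists_formEps hb ha h₀ h₁ ε
  obtain ⟨c, hc, hcoer⟩ := formEps_coercive ha hb h₀ h₁ hε
  obtain ⟨u, hu⟩ := (isEigenvalue_iff hB μ).1 hμ
  exact hu.pos hc fun u => by rw [hB]; exact hcoer u

theorem finite_isEigenvalue_le (ha : a < 0) (hb : 0 < b) (h₀ : IsStiffness (Ioo a 0) k₀)
    (h₁ : IsStiffness (Ioo 0 b) k₁) (hε : 0 < ε) (Λ : ℝ) :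
    ({μ | IsEigenvalue a b k₀ k₁ ε μ} ∩ Iic Λ).Finite := by
  obtain ⟨B, hB⟩ := exists_formEps hb ha h₀ h₁ ε
  obtain ⟨c, hc, hcoer⟩ := formEps_coercive ha hb h₀ h₁ hε
  refine (finite_eigenvalues_le (B := B) (fun u v => by rw [hB, hB, formEps_symm]) hc
    (fun u => by rw [hB]; exact hcoer u)
    (isCompactOperator_inclusionL2 (ha.trans hb).le) Λ).subset fun μ hμ => ?_
  exact ⟨(isEigenvalue_iff hB μ).1 hμ.1, hμ.2⟩

theorem finrank_le_ncard_isEigenvalue (ha : a < 0) (hb : 0 < b)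
    (h₀ : IsStiffness (Ioo a 0) k₀) (h₁ : IsStiffness (Ioo 0 b) k₁) (hε : 0 < ε)
    (S : Submodule ℝ (H02 a b)) [FiniteDimensional ℝ S]
    (hS : ∀ u ∈ S, inclusionL2 a b u = 0 → u = 0) {Λ : ℝ}
    (hΛ : ∀ u ∈ S, formEps k₀ k₁ ε (u : L2 a b × L2 a b) u ≤ Λ * ‖inclusionL2 a b u‖ ^ 2) :
    Module.finrank ℝ S ≤ ({μ | IsEigenvalue a b k₀ k₁ ε μ} ∩ Iic Λ).ncard := by
  obtain ⟨B, hB⟩ := exists_formEps hb ha h₀ h₁ ε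
  obtain ⟨c, hc, hcoer⟩ := formEps_coercive ha hb h₀ h₁ hε
  have h := finrank_le_ncard_eigenvalues (B := B) (fun u v => by rw [hB, hB, formEps_symm]) hc
    (fun u => by rw [hB]; exact hcoer u) (isCompactOperator_inclusionL2 (ha.trans hb).le)
    (simpleSpectrum ha hb h₀ h₁ hε hB) S hS (Λ := Λ) (fun u hu => by rw [hB]; exact hΛ u hu)
  have e : {μ | IsEigenvalue a b k₀ k₁ ε μ} ∩ Iic Λ =
      {μ | (∃ u, IsFormEigenvector B (inclusionL2 a b) μ u) ∧ μ ≤ Λ} := by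
    ext μ; simp [isEigenvalue_iff hB]
  rwa [e]

/-- A finite spectrum would be outnumbered by a trial space of one dimension more. -/
theorem infinite_isEigenvalue (ha : a < 0) (hb : 0 < b)
    (h₀ : IsStiffness (Ioo a 0) k₀) (h₁ : IsStiffness (Ioo 0 b) k₁) (hε : 0 < ε) :
    {μ | IsEigenvalue a b k₀ k₁ ε μ}.Infinite := by
  intro hfin
  obtain ⟨S, hfd, hdim, hinj, C, hC⟩ := exists_submodule_formEps_le ha hb h₀ h₁
    ({μ | IsEigenvalue a b k₀ k₁ ε μ}.ncard + 1)
  have h1 := finrank_le_ncard_isEigenvalue ha hb h₀ h₁ hε S hinj (hC ε)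
  have h2 := Set.ncard_le_ncard (inter_subset_left (s := {μ | IsEigenvalue a b k₀ k₁ ε μ})
    (t := Iic (C * ε ^ 4))) hfin
  omega

theorem eigenvalue_le_of_submodule (ha : a < 0) (hb : 0 < b)
    (h₀ : IsStiffness (Ioo a 0) k₀) (h₁ : IsStiffness (Ioo 0 b) k₁) (hε : 0 < ε)
    (S : Submodule ℝ (H02 a b)) [FiniteDimensional ℝ S] {n : ℕ}
    (hdim : Module.finrank ℝ S = n + 1)
    (hS : ∀ u ∈ S, inclusionL2 a b u = 0 → u = 0) {Λ : ℝ}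
    (hΛ : ∀ u ∈ S, formEps k₀ k₁ ε (u : L2 a b × L2 a b) u ≤ Λ * ‖inclusionL2 a b u‖ ^ 2) :
    eigenvalue a b k₀ k₁ ε n ≤ Λ := by
  refine enum_le_of_lt_ncard (infinite_isEigenvalue ha hb h₀ h₁ hε)
    (finite_isEigenvalue_le ha hb h₀ h₁ hε) rfl (fun i => rfl) ?_
  have := finrank_le_ncard_isEigenvalue ha hb h₀ h₁ hε S hS hΛ
  omega

theorem eigenvalue_strictMono (ha : a < 0) (hb : 0 < b)
    (h₀ : IsStiffness (Ioo a 0) k₀) (h₁ : IsStiffness (Ioo 0 b) k₁) (hε : 0 < ε) :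
    StrictMono (eigenvalue a b k₀ k₁ ε) :=
  enum_strictMono (infinite_isEigenvalue ha hb h₀ h₁ hε)
    (finite_isEigenvalue_le ha hb h₀ h₁ hε) fun _ => rfl

theorem isEigenvalue_eigenvalue (ha : a < 0) (hb : 0 < b)
    (h₀ : IsStiffness (Ioo a 0) k₀) (h₁ : IsStiffness (Ioo 0 b) k₁) (hε : 0 < ε) (n : ℕ) :
    IsEigenvalue a b k₀ k₁ ε (eigenvalue a b k₀ k₁ ε n) :=
  enum_mem (infinite_isEigenvalue ha hb h₀ h₁ hε)
    (finite_isEigenvalue_le ha hb h₀ h₁ hε) rfl (fun _ => rfl) n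

/-- Comparison of the eigenvalues for two values of the parameter. -/
theorem eigenvalue_le_mul (ha : a < 0) (hb : 0 < b)
    (h₀ : IsStiffness (Ioo a 0) k₀) (h₁ : IsStiffness (Ioo 0 b) k₁) (hε : 0 < ε) {δ : ℝ}
    (hδ : 0 < δ) (n : ℕ) :
    eigenvalue a b k₀ k₁ ε n ≤ max 1 ((ε / δ) ^ 4) * eigenvalue a b k₀ k₁ δ n := by
  obtain ⟨B, hB⟩ := exists_formEps hb ha h₀ h₁ δ
  have hm := eigenvalue_strictMono ha hb h₀ h₁ hδ
  have hex : ∀ i : Fin (n + 1), ∃ u,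
      IsFormEigenvector B (inclusionL2 a b) (eigenvalue a b k₀ k₁ δ i) u := fun i =>
    (isEigenvalue_iff hB _).1 (isEigenvalue_eigenvalue ha hb h₀ h₁ hδ i)
  choose u hu using hex
  -- The eigenvectors for `δ` with indices `0, …, n` serve as the trial space for `ε`.
  obtain ⟨S, hfd, hdim, hinj, hS⟩ := exists_submodule_of_eigenvectors (B := B)
    (fun u v => by rw [hB, hB, formEps_symm])
    (μ := fun i : Fin (n + 1) => eigenvalue a b k₀ k₁ δ i)
    (fun i j h => Fin.ext (hm.injective h)) hu (Λ := eigenvalue a b k₀ k₁ δ n)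
    fun i => hm.monotone (Nat.lt_succ_iff.1 i.2)
  refine eigenvalue_le_of_submodule ha hb h₀ h₁ hε S hdim hinj fun v hv => ?_
  refine (formEps_le_mul h₀ h₁ hδ _).trans ?_
  have h1 := hS v hv
  rw [hB] at h1
  rw [mul_assoc]
  exact mul_le_mul_of_nonneg_left h1 (by positivity)

/-- The comparison inequality, used in both directions, squeezes the value at `ε` between two
functions continuous at `δ` that agree there. -/
theorem continuousOn_eigenvalue (ha : a < 0) (hb : 0 < b)
    (h₀ : IsStiffness (Ioo a 0) k₀) (h₁ : IsStiffness (Ioo 0 b) k₁) (n : ℕ) :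
    ContinuousOn (fun ε => eigenvalue a b k₀ k₁ ε n) (Ioi 0) := by
  intro δ hδ
  have hδ : 0 < δ := hδ
  have hlow : ContinuousAt (fun ε : ℝ => eigenvalue a b k₀ k₁ δ n / max 1 ((δ / ε) ^ 4)) δ :=
    continuousAt_const.div (continuousAt_const.max
      ((continuousAt_const.div continuousAt_id hδ.ne').pow 4)) (by positivity)
  have hup : ContinuousAt (fun ε : ℝ => max 1 ((ε / δ) ^ 4) * eigenvalue a b k₀ k₁ δ n) δ := by
    fun_prop
  have e1 : eigenvalue a b k₀ k₁ δ n / max 1 ((δ / δ) ^ 4) = eigenvalue a b k₀ k₁ δ n := by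
    simp [div_self hδ.ne']
  have e2 : max 1 ((δ / δ) ^ 4) * eigenvalue a b k₀ k₁ δ n = eigenvalue a b k₀ k₁ δ n := by
    simp [div_self hδ.ne']
  have t1 := hlow.tendsto
  have t2 := hup.tendsto
  simp only [e1] at t1
  simp only [e2] at t2
  refine tendsto_of_tendsto_of_tendsto_of_le_of_le' (t1.mono_left nhdsWithin_le_nhds)
    (t2.mono_left nhdsWithin_le_nhds) ?_ ?_
  · filter_upwards [self_mem_nhdsWithin] with ε hε
    rw [div_le_iff₀ (by positivity), mul_comm]
    exact eigenvalue_le_mul ha hb h₀ h₁ hδ hε n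
  · filter_upwards [self_mem_nhdsWithin] with ε hε
    exact eigenvalue_le_mul ha hb h₀ h₁ hε hδ n

end Eigenvalues

end StiffRod

theorem lemma2p1 (a b : ℝ) (ha : a < 0) (hb : 0 < b) (k₀ k₁ : ℝ → ℝ)
    (hk₀ : ContDiffOn ℝ ∞ k₀ (Set.Ioo a 0)) (hk₁ : ContDiffOn ℝ ∞ k₁ (Set.Ioo 0 b))
    (hk₀_bdd : ∃ m M : ℝ, 0 < m ∧ ∀ x ∈ Set.Ioo a 0, m ≤ k₀ x ∧ k₀ x ≤ M)
    (hk₁_bdd : ∃ m M : ℝ, 0 < m ∧ ∀ x ∈ Set.Ioo 0 b, m ≤ k₁ x ∧ k₁ x ≤ M) :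
    -- the listing is a genuine one: `0 < λ₁ < λ₂ < ⋯ → ∞`, and these are all the eigenvalues
    (∀ ε ∈ Set.Ioo (0 : ℝ) 1,
      0 < StiffRod.eigenvalue a b k₀ k₁ ε 0 ∧
      StrictMono (StiffRod.eigenvalue a b k₀ k₁ ε) ∧
      Filter.Tendsto (StiffRod.eigenvalue a b k₀ k₁ ε) Filter.atTop Filter.atTop ∧
      Set.range (StiffRod.eigenvalue a b k₀ k₁ ε) =
        {μ | StiffRod.IsEigenvalue a b k₀ k₁ ε μ}) ∧
    ∀ i : ℕ,
      ContinuousOn (fun ε => StiffRod.eigenvalue a b k₀ k₁ ε i) (Set.Ioo (0 : ℝ) 1) ∧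
      ∃ C : ℝ, ∀ ε ∈ Set.Ioo (0 : ℝ) 1,
        StiffRod.eigenvalue a b k₀ k₁ ε i ≤ C * ε ^ 4 := by
  have h₀ : StiffRod.IsStiffness (Ioo a 0) k₀ := ⟨hk₀.continuousOn, hk₀_bdd⟩
  have h₁ : StiffRod.IsStiffness (Ioo 0 b) k₁ := ⟨hk₁.continuousOn, hk₁_bdd⟩
  refine ⟨fun ε hε => ?_, fun i => ⟨?_, ?_⟩⟩
  · have hinf := StiffRod.infinite_isEigenvalue ha hb h₀ h₁ hε.1
    have hfin := StiffRod.finite_isEigenvalue_le ha hb h₀ h₁ hε.1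
    exact ⟨StiffRod.isEigenvalue_pos ha hb h₀ h₁ hε.1
        (StiffRod.isEigenvalue_eigenvalue ha hb h₀ h₁ hε.1 0),
      StiffRod.eigenvalue_strictMono ha hb h₀ h₁ hε.1,
      StiffRod.enum_tendsto hinf hfin rfl fun _ => rfl,
      StiffRod.range_enum hinf hfin rfl fun _ => rfl⟩
  · exact (StiffRod.continuousOn_eigenvalue ha hb h₀ h₁ i).mono fun ε hε => hε.1
  -- The trial space and `C` are chosen before `ε`; the dimension is `i + 1` because indices start
  -- at `0`.
  · obtain ⟨S, hfd, hdim, hinj, C, hC⟩ := StiffRod.exists_submodule_formEps_le ha hb h₀ h₁ (i + 1)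
    exact ⟨C, fun ε hε =>
      StiffRod.eigenvalue_le_of_submodule ha hb h₀ h₁ hε.1 S hdim hinj (hC ε)⟩
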